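/- **Conventions.** Let $G=(V,E)$, $E\subseteq V\times V$, be a finite digraph with $n=|V|$ that is plane, i.e. given with a planar cyclic ordering $\pi_v$ of the edges around every vertex $v$. $G$ is *acyclic* if it has no directed cycle and *single-source* if some vertex $s$ reaches all vertices. A subgraph $H$ inherits the embedding; a *corner* of $H$ lies between two consecutive edges of $H$ around a vertex, and belongs to one face of $H$. A corner of a face is a *source* if it lies between two outgoing edges and a *target* if it lies between two ingoing edges (at a vertex of degree one the two edges coincide); the face has *alternation number* $2a$ if it has $a$ source and $a$ target corners. $G^*$ is the dual graph, whose vertices are the faces of $G$; for a connected subgraph $H$ of $G$, the faces of $H$ correspond to the connected components of $G^*\setminus E^*[H]$ (the dual with the edges dual to edges of $H$ deleted). The *backward closure* $\mathrm{bc}(f)$ of a face $f$ of $G$ is the smallest subgraph $H$ that contains all vertices incident to $f$ and contains every edge $(u,v)\in E$ with $v\in V[H]$. For subgraphs $A,B$, $A\setminus B$ is $A$ with the vertices of $B$ (and the edges at them) deleted. An *s-t-decomposition* of $G$ is a rooted tree in which each node $x$ is associated with a face $f_x$ of $G$, subgraphs $S_x,C_x\subseteq G$ and an induced subgraph $G^*_x$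 of $G^*$ such that (every node being a descendant of itself) * $f_x\ne f_y$ for $x\neq y$; * $S_x=C_x=\mathrm{bc}(f_x)$ if $x$ is the root, while $S_x=\mathrm{bc}(f_x)\cup S_y$ and $C_x=\mathrm{bc}(f_x)\setminus S_y$ if $x$ is a child of $y$; * $G^*_x$ is induced by $\{f_z : z \text{ a descendant of } x\}$; it has all faces of $G$ as vertices if $x$ is the root, and if $x$ is a child of $y$ its vertices are exactly those of the connected component of $G^*\setminus E^*[S_y]$ that contains $f_x$. If $x$ is a child of $y$, the *parent frame* $F_x$ of $x$ is the face cycle of $S_y$ that corresponds to $G^*_x$, and the set $E_x$ of *down-edges* consists of the edges $(w,w')\in E$ with $w\in V[F_x]$ and $w'\in V[C_z]$ for some descendant $z$ of $x$. **Theorem.** There is an absolute constant $K$ such that every acyclic single-source plane digraph $G$ on $n$ vertices has a *good* s-t-decomposition: one whose tree has height at most $K\log n$ and in which every parent frame has alternation number $2$ or $4$. -/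

import Mathlib

universe u

/-! ### Digraphs, edges, darts and subgraphs -/

namespace Digraph

variable {V : Type u}

/-- The edges `(u, v)` of a digraph. -/
abbrev Edge (G : Digraph V) : Type u := {p : V × V // G.Adj p.1 p.2}

/-- The initial vertex `u` of an edge `(u, v)`. -/
def Edge.tail {G : Digraph V} (e : G.Edge) : V := e.1.1

/-- The final vertex `v` of an edge `(u, v)`. -/
def Edge.head {G : Digraph V} (e : G.Edge) : V := e.1.2

/-- A dart (half-edge) is an edge together with one of its two ends:
`(e, true)` is the end of `e` at its tail, `(e, false)` the end of `e` at its head. -/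
abbrev Dart (G : Digraph V) : Type u := G.Edge × Bool

/-- The vertex at which a dart sits. -/
def Dart.base {G : Digraph V} (d : G.Dart) : V := if d.2 then d.1.tail else d.1.head

/-- The dart at the other end of the same edge. -/
def Dart.rev {G : Digraph V} (d : G.Dart) : G.Dart := (d.1, !d.2)

/-- `u` can reach `v` by a (possibly empty) directed path. -/
def Reaches (G : Digraph V) (u v : V) : Prop := Relation.ReflTransGen G.Adj u v

/-- There is no directed cycle. -/
def IsAcyclic (G : Digraph V) : Prop := ∀ v, ¬ Relation.TransGen G.Adj v v

/-- Some vertex `s` reaches all vertices. -/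
def IsSingleSource (G : Digraph V) : Prop := ∃ s, ∀ v, G.Reaches s v

/-- A (not necessarily induced) subgraph of a digraph. -/
@[ext]
structure Subdigraph (G : Digraph V) where
  verts : Set V
  edges : Set G.Edge
  tail_mem : ∀ e ∈ edges, e.tail ∈ verts
  head_mem : ∀ e ∈ edges, e.head ∈ verts

namespace Subdigraph

variable {G : Digraph V}

instance : PartialOrder G.Subdigraph where
  le H K := H.verts ⊆ K.verts ∧ H.edges ⊆ K.edges
  le_refl _ := ⟨subset_rfl, subset_rfl⟩
  le_trans _ _ _ h k := ⟨h.1.trans k.1, h.2.trans k.2⟩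
  le_antisymm _ _ h k :=
    Subdigraph.ext (Set.Subset.antisymm h.1 k.1) (Set.Subset.antisymm h.2 k.2)

/-- The whole digraph, as a subgraph of itself. -/
def whole (G : Digraph V) : G.Subdigraph where
  verts := Set.univ
  edges := Set.univ
  tail_mem _ _ := trivial
  head_mem _ _ := trivial

/-- The union `H ∪ K` of two subgraphs. -/
def union (H K : G.Subdigraph) : G.Subdigraph where
  verts := H.verts ∪ K.verts
  edges := H.edges ∪ K.edges
  tail_mem e h := h.imp (H.tail_mem e) (K.tail_mem e)
  head_mem e h := h.imp (H.head_mem e) (K.head_mem e)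

/-- The subgraph `H ∖ K`: the vertices of `K`, and all edges at them, are deleted from `H`. -/
def diff (H K : G.Subdigraph) : G.Subdigraph where
  verts := H.verts \ K.verts
  edges := {e ∈ H.edges | e.tail ∉ K.verts ∧ e.head ∉ K.verts}
  tail_mem e h := ⟨H.tail_mem e h.1, h.2.1⟩
  head_mem e h := ⟨H.head_mem e h.1, h.2.2⟩

/-- `H` contains every edge of `G` whose final vertex is in `H`. -/
def IsBackwardClosed (H : G.Subdigraph) : Prop := ∀ e : G.Edge, e.head ∈ H.verts → e ∈ H.edges

/-- The backward closure of a set of vertices: all vertices that can reach it, and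
all edges that end in such a vertex. -/
def backwardClosure (G : Digraph V) (A : Set V) : G.Subdigraph where
  verts := {u | ∃ v ∈ A, G.Reaches u v}
  edges := {e | ∃ v ∈ A, G.Reaches e.head v}
  tail_mem e := fun ⟨v, hv, h⟩ => ⟨v, hv, Relation.ReflTransGen.head e.2 h⟩
  head_mem _ h := h

/-- The backward closure of `A` is the smallest backward closed subgraph that contains `A`. -/
theorem isLeast_backwardClosure (G : Digraph V) (A : Set V) :
    IsLeast {H : G.Subdigraph | H.IsBackwardClosed ∧ A ⊆ H.verts} (backwardClosure G A) := by
  refine ⟨⟨fun e h => h, fun v hv => ⟨v, hv, Relation.ReflTransGen.refl⟩⟩, ?_⟩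
  rintro H ⟨hH, hA⟩
  have key : ∀ u v, v ∈ A → G.Reaches u v → u ∈ H.verts := by
    intro u v hv h
    induction h using Relation.ReflTransGen.head_induction_on with
    | refl => exact hA hv
    | head hab _ ih => exact H.tail_mem _ (hH ⟨(_, _), hab⟩ ih)
  exact ⟨fun u ⟨v, hv, h⟩ => key u v hv h, fun e ⟨v, hv, h⟩ => hH e (key _ v hv h)⟩

end Subdigraph

end Digraph

/-! ### Embedded digraphs, corners and faces -/

/-- A digraph with a rotation system: a permutation of the darts that permutes the darts at each
vertex `v` cyclically (the counterclockwise order `π_v` of the edges around `v`). -/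
structure EmbeddedDigraph (V : Type u) extends Digraph V where
  rot : Equiv.Perm toDigraph.Dart
  isCycleOn_rot : ∀ v, rot.IsCycleOn {d | d.base = v}

namespace EmbeddedDigraph

variable {V : Type u} [Finite V] (G : EmbeddedDigraph V)

/-- Subgraphs of an embedded digraph. They inherit its embedding. -/
abbrev Sub : Type u := G.toDigraph.Subdigraph

variable {G}

namespace Sub

/-- The darts of a subgraph. -/
abbrev Dart (H : G.Sub) : Type u := {d : G.toDigraph.Dart // d.1 ∈ H.edges}

variable {H : G.Sub}

theorem exists_return (d : H.Dart) :
    {k : ℕ | 0 < k ∧ ((G.rot ^ k) d.1).1 ∈ H.edges}.Nonempty :=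
  ⟨orderOf G.rot, orderOf_pos _, by rw [pow_orderOf_eq_one]; exact d.2⟩

/-- The number of steps around the vertex from `d` to the next dart of the subgraph. -/
noncomputable def step (d : H.Dart) : ℕ :=
  sInf {k : ℕ | 0 < k ∧ ((G.rot ^ k) d.1).1 ∈ H.edges}

/-- The next dart of the subgraph around the vertex of `d`, in the inherited rotation. -/
noncomputable def next (d : H.Dart) : H.Dart :=
  ⟨(G.rot ^ step d) d.1, (Nat.sInf_mem (exists_return d)).2⟩

/-- The other end of a dart, in the subgraph. -/
def rev (d : H.Dart) : H.Dart := ⟨d.1.rev, d.2⟩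

variable (H)

/-- The corners of a subgraph `H`. A dart `d` of `H` stands for the corner between `d` and the
next dart of `H` around the same vertex; a vertex without edges in `H` has one corner. -/
abbrev Corner : Type u :=
  H.Dart ⊕ {v : V // v ∈ H.verts ∧ ∀ e ∈ H.edges, e.tail ≠ v ∧ e.head ≠ v}

variable {H}

/-- The vertex at which a corner sits. -/
def cornerVertex : H.Corner → V
  | Sum.inl d => d.1.base
  | Sum.inr v => v.1

/-- `c'` follows `c` along the boundary of a face: from the corner between `d` and `next d`, walk
along the edge of `next d` to its other end, keeping the face on the right-hand side. -/
def Consecutive (c c' : H.Corner) : Prop :=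
  ∃ d : H.Dart, c = Sum.inl d ∧ c' = Sum.inl (rev (next d))

variable (H)

/-- The faces of a subgraph, for its inherited embedding: the closed boundary walks, each of them
given as a class of corners. -/
def Face : Type u := Quot (Consecutive (H := H))

variable {H}

/-- The face that a corner belongs to. -/
def faceOf (c : H.Corner) : H.Face := Quot.mk _ c

/-- The vertices incident to a face. -/
def Face.verts (F : H.Face) : Set V := {v | ∃ c : H.Corner, faceOf c = F ∧ cornerVertex c = v}

/-- The source corners of a face: those between two outgoing edges. -/
def Face.sources (F : H.Face) : Set H.Dart :=
  {d | faceOf (Sum.inl d) = F ∧ d.1.2 = true ∧ (next d).1.2 = true}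

/-- The target corners of a face: those between two ingoing edges. -/
def Face.targets (F : H.Face) : Set H.Dart :=
  {d | faceOf (Sum.inl d) = F ∧ d.1.2 = false ∧ (next d).1.2 = false}

/-- The boundary of `F` has `a` source corners and `a` target corners, where `k = 2 * a`. -/
def Face.HasAlternationNumber (F : H.Face) (k : ℕ) : Prop :=
  ∃ a, k = 2 * a ∧ F.sources.ncard = a ∧ F.targets.ncard = a

end Sub

variable (G)

/-- The corners of `G`. -/
abbrev Corner : Type u := Sub.Corner (G := G) (Digraph.Subdigraph.whole G.toDigraph)

/-- The faces of `G`, which are the vertices of the dual graph. -/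
abbrev Face : Type u := Sub.Face (G := G) (Digraph.Subdigraph.whole G.toDigraph)

variable {G}

/-- The face of `G` that a corner of `G` belongs to. -/
abbrev faceOf (c : G.Corner) : G.Face := Sub.faceOf c

/-- The corner of `G` between a dart and the next dart around the same vertex. -/
def cornerAt (d : G.toDigraph.Dart) : G.Corner := Sum.inl ⟨d, trivial⟩

variable (G)

/-- The digraph is embedded in the plane (equivalently, the sphere): Euler's formula holds. For a
digraph with several connected components it says that each component is so embedded. -/
def IsPlane : Prop :=
  Nat.card V + Nat.card G.Face =
    Nat.card G.toDigraph.Edge +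
      2 * Nat.card G.toDigraph.toSimpleGraphInclusive.ConnectedComponent

variable {G}

/-- The backward closure of a face. -/
def bc (f : G.Face) : G.Sub := Digraph.Subdigraph.backwardClosure G.toDigraph f.verts

/-- `f` and `g` are joined by an edge of the dual graph that is dual to an edge outside `H`.
The edge `e` has the face of the corner `(e, true)` on its left and that of `(e, false)` on its
right. -/
def DualAdj (H : G.Sub) (f g : G.Face) : Prop :=
  ∃ e : G.toDigraph.Edge, e ∉ H.edges ∧
    ((faceOf (cornerAt (e, true)) = f ∧ faceOf (cornerAt (e, false)) = g) ∨
      (faceOf (cornerAt (e, true)) = g ∧ faceOf (cornerAt (e, false)) = f))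

/-- The (vertex set of the) connected component of `f` in the dual graph without the edges dual to
edges of `H`. -/
def dualComponent (H : G.Sub) (f : G.Face) : Set G.Face :=
  {g | Relation.ReflTransGen (DualAdj H) f g}

/-- The consecutive corners of `G` that make up a corner of the subgraph `H`. -/
def Sub.subcorners {H : G.Sub} : H.Corner → Set G.Corner
  | Sum.inl d => {c | ∃ j < Sub.step d, c = cornerAt ((G.rot ^ j) d.1)}
  | Sum.inr v => {c | Sub.cornerVertex c = v.1}

/-- The subfaces of a face `F` of the subgraph `H`: the faces of `G` that lie in `F`. They are those
that can be connected, in the dual graph without the edges of `H`, to a face of `G` with a corner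
inside a corner of `F`. -/
def Sub.Face.subfaces {H : G.Sub} (F : H.Face) : Set G.Face :=
  {g | ∃ c : H.Corner, Sub.faceOf c = F ∧
    ∃ c' ∈ Sub.subcorners c, g ∈ dualComponent H (faceOf c')}

variable (G)

/-- An s-t-decomposition of `G`. Rooted trees are ordered with the root `⊥` at the bottom: `x ≤ y`
means that `x` is an ancestor of `y` (every node is an ancestor and a descendant of itself), and
the parent of a node `x ≠ ⊥` is `Order.pred x`. -/
structure STDecomposition where
  /-- The rooted tree. -/
  tree : RootedTree.{u}
  /-- The face `f_x`. -/
  face : tree → G.Face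
  /-- The subgraph `S_x`. -/
  S : tree → G.Sub
  /-- The subgraph `C_x`. -/
  C : tree → G.Sub
  /-- The set of vertices of the induced subgraph `G*_x` of the dual graph. -/
  dualVerts : tree → Set G.Face
  /-- The parent frame `F_x` of a node with a parent `y`: a face cycle of `S_y`. -/
  frame : ∀ x : tree, x ≠ ⊥ → Sub.Face (S (Order.pred x))
  /-- The set `E_x` of down-edges of a node with a parent. -/
  downEdges : ∀ x : tree, x ≠ ⊥ → Set G.toDigraph.Edge
  face_injective : Function.Injective face
  S_root : S ⊥ = bc (face ⊥)
  S_child : ∀ x, x ≠ ⊥ → S x = (bc (face x)).union (S (Order.pred x))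
  C_root : C ⊥ = bc (face ⊥)
  C_child : ∀ x, x ≠ ⊥ → C x = (bc (face x)).diff (S (Order.pred x))
  dualVerts_eq : ∀ x, dualVerts x = {f | ∃ z, x ≤ z ∧ face z = f}
  dualVerts_root : dualVerts ⊥ = Set.univ
  dualVerts_child : ∀ x, x ≠ ⊥ → dualVerts x = dualComponent (S (Order.pred x)) (face x)
  /-- `F_x` is the face of `S_y` that corresponds to `G*_x`. -/
  subfaces_frame : ∀ x (hx : x ≠ ⊥), (frame x hx).subfaces = dualVerts x
  downEdges_eq : ∀ x (hx : x ≠ ⊥), downEdges x hx =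
    {e | e.tail ∈ (frame x hx).verts ∧ ∃ z, x ≤ z ∧ e.head ∈ (C z).verts}

variable {G}

namespace STDecomposition

/-- The depth of a node: the number of its proper ancestors. -/
noncomputable def depth (D : G.STDecomposition) (x : D.tree) : ℕ := (Set.Iio x).ncard

/-- The tree has height at most `h`. -/
def HeightLE (D : G.STDecomposition) (h : ℝ) : Prop := ∀ x, (D.depth x : ℝ) ≤ h

/-- Every parent frame has alternation number 2 or 4. -/
def FramesTwoOrFour (D : G.STDecomposition) : Prop :=
  ∀ x (hx : x ≠ ⊥),
    (D.frame x hx).HasAlternationNumber 2 ∨ (D.frame x hx).HasAlternationNumber 4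

end STDecomposition

end EmbeddedDigraph

namespace EmbeddedDigraph

open Digraph

variable {V : Type u}

/-! ### The inherited rotation of a subgraph -/

section Rotation

variable {G : EmbeddedDigraph V}

/-! For a backward closed subgraph `H` that contains the source `s`, the components of the dual
without the edges of `H` play the role of faces. As `G` is acyclic, following a boundary walk along
edge directions leads to a target corner, and a face has as many source as target corners. So it
suffices to keep at most two target corners in every component that still has to be split.

Let `K` be `H` together with `bc f`. By Euler's formula (`card_quotient_add_card_verts`) the gain in
components is the number of new edges minus the number of new vertices. Count target corners at new
vertices by their first edges. A new vertex with an outgoing edge has an ingoing edge that starts no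
target corner; a new vertex without one lies on `f` and has a target corner in `f`. Hence the new
target corners outside `f` do not outnumber the gain. But every changed component other than `{f}`
has one, and these components are at least as many as the gain. So each has exactly one
(`newTargets_unique`), and the backward closure of the face at this corner already bounds the
component (`exists_face_closed`).

This allows a balanced choice of `f` (`exists_face_select`) in a component `F` with at most two
target corners of `H`. Call a part of `F` bad if it inherits two of these corners, or if it is
larger than half of `F` and either inherits one or `F` has at most one. Two disjoint parts cannot
both be bad. If every choice left a bad part, moving to the face that bounds it would leave a
strictly smaller bad part, without end. A part that is not bad inherits at most one corner and
receives at most one new one; it has at most half the size, or `F` had two corners and the part has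
at most one. Thus the squared size, doubled when there are two target corners, at least halves in
every step. The depth is at most the binary logarithm of the squared number of faces. -/

theorem base_rot (d : G.toDigraph.Dart) : (G.rot d).base = d.base :=
  ((G.isCycleOn_rot d.base).1.mapsTo (show d ∈ {x | x.base = d.base} from rfl))

theorem base_rot_pow (k : ℕ) (d : G.toDigraph.Dart) : ((G.rot ^ k) d).base = d.base := by
  induction k with
  | zero => rfl
  | succ k ih => rw [pow_succ', Equiv.Perm.mul_apply, base_rot, ih]

theorem rev_rev (d : G.toDigraph.Dart) : d.rev.rev = d := by
  simp [Dart.rev]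

theorem base_of_true {d : G.toDigraph.Dart} (h : d.2 = true) : d.base = d.1.tail := by
  simp [Dart.base, h]

theorem base_of_false {d : G.toDigraph.Dart} (h : d.2 = false) : d.base = d.1.head := by
  simp [Dart.base, h]

theorem base_symm_rot (d : G.toDigraph.Dart) : (G.rot.symm d).base = d.base := by
  rw [← base_rot, Equiv.apply_symm_apply]

theorem rev_cases (d : G.toDigraph.Dart) :
    (d = (d.1, true) ∧ d.rev = (d.1, false)) ∨ (d = (d.1, false) ∧ d.rev = (d.1, true)) := by
  obtain ⟨e, b⟩ := d
  cases b <;> simp [Dart.rev]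

theorem Sub.step_le {H : G.Sub} {d : H.Dart} {k : ℕ} (hk : 0 < k) (h : ((G.rot ^ k) d.1).1 ∈ H.edges) :
    Sub.step d ≤ k := Nat.sInf_le ⟨hk, h⟩

theorem Sub.rot_pow_notMem {H : G.Sub} {d : H.Dart} {j : ℕ} (h0 : 0 < j) (h : j < Sub.step d) :
    ((G.rot ^ j) d.1).1 ∉ H.edges :=
  fun h' => absurd (Sub.step_le h0 h') (by omega)

variable [Finite V]

theorem exists_rot_pow {d d' : G.toDigraph.Dart} (h : d.base = d'.base) :
    ∃ k : ℕ, (G.rot ^ k) d = d' :=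
  (G.isCycleOn_rot d'.base).exists_pow_eq' (Set.toFinite _) h rfl

namespace Sub

variable {H : G.Sub}

theorem step_pos (d : H.Dart) : 0 < step d := (Nat.sInf_mem (exists_return d)).1

theorem base_next (d : H.Dart) : (next d).1.base = d.1.base := base_rot_pow _ _

/-- If two darts with the same successor had different steps, the one with the shorter step would
lie strictly inside the gap after the other. -/
theorem next_injective : Function.Injective (next (H := H)) := by
  have key : ∀ a b : H.Dart, step a ≤ step b → next a = next b → a = b := by
    intro a b hab h
    have h1 : (G.rot ^ step a) a.1 = (G.rot ^ step b) b.1 := congrArg Subtype.val h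
    obtain ⟨m, hm⟩ := Nat.exists_eq_add_of_le hab
    rw [hm, pow_add, Equiv.Perm.mul_apply] at h1
    have h2 := (G.rot ^ step a).injective h1
    rcases Nat.eq_zero_or_pos m with rfl | hm0
    · exact Subtype.ext (by simpa using h2)
    · have := step_le hm0 (h2 ▸ a.2)
      have := step_pos a
      omega
  intro a b h
  rcases le_total (step a) (step b) with hab | hab
  · exact key a b hab h
  · exact (key b a hab h.symm).symm

theorem next_surjective : Function.Surjective (next (H := H)) :=
  Finite.surjective_of_injective next_injective

/-- A property of darts of `H` that is passed on to the next dart holds around a vertex. -/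
theorem next_induction {P : H.Dart → Prop} (hP : ∀ d, P d → P (next d)) {d d' : H.Dart}
    (h : d.1.base = d'.1.base) (hd : P d) : P d' := by
  obtain ⟨k, hk⟩ := exists_rot_pow h
  induction k using Nat.strong_induction_on generalizing d with
  | _ k ih =>
    rcases Nat.eq_zero_or_pos k with rfl | hk0
    · have : d = d' := Subtype.ext (by simpa using hk)
      exact this ▸ hd
    · have hle := step_le (d := d) hk0 (by rw [hk]; exact d'.2)
      have := step_pos d
      refine ih (k - step d) (by omega) ((base_next d).trans h) (hP d hd) ?_
      change (G.rot ^ (k - step d)) ((G.rot ^ step d) d.1) = d'.1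
      rw [← Equiv.Perm.mul_apply, ← pow_add, Nat.sub_add_cancel hle, hk]

/-- Every dart of `G` at a vertex with darts of `H` lies inside a corner of `H`. -/
theorem exists_eq_rot_pow {d : H.Dart} {d' : G.toDigraph.Dart} (h : d.1.base = d'.base) :
    ∃ e : H.Dart, e.1.base = d'.base ∧ ∃ j < step e, (G.rot ^ j) e.1 = d' := by
  obtain ⟨k, hk⟩ := exists_rot_pow h
  induction k using Nat.strong_induction_on generalizing d with
  | _ k ih =>
    by_cases hlt : k < step d
    · exact ⟨d, h, k, hlt, hk⟩
    · have := step_pos d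
      refine ih (k - step d) (by omega) (d := next d) ((base_next d).trans h) ?_
      change (G.rot ^ (k - step d)) ((G.rot ^ step d) d.1) = d'
      rw [← Equiv.Perm.mul_apply, ← pow_add, Nat.sub_add_cancel (by omega), hk]

/-- If the next dart of a larger subgraph lies in the smaller one, it is the next dart there. -/
theorem next_eq_of_le {K : G.Sub} (hHK : H.edges ⊆ K.edges) {d : G.toDigraph.Dart}
    (h : d.1 ∈ H.edges) (hn : (next (⟨d, hHK h⟩ : K.Dart)).1.1 ∈ H.edges) :
    (next (⟨d, h⟩ : H.Dart)).1 = (next (⟨d, hHK h⟩ : K.Dart)).1 := by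
  have h1 : step (⟨d, h⟩ : H.Dart) ≤ step (⟨d, hHK h⟩ : K.Dart) := step_le (step_pos _) hn
  have h2 : step (⟨d, hHK h⟩ : K.Dart) ≤ step (⟨d, h⟩ : H.Dart) :=
    step_le (step_pos _) (hHK (next (⟨d, h⟩ : H.Dart)).2)
  change (G.rot ^ _) d = (G.rot ^ _) d
  rw [le_antisymm h1 h2]

end Sub

end Rotation

variable [Finite V] {G : EmbeddedDigraph V}

/-! ### The dual graph -/

/-- The face of `G` at the corner that starts with the dart `d`. -/
def dartFace (d : G.toDigraph.Dart) : G.Face := faceOf (cornerAt d)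

theorem next_whole (d : Sub.Dart (Subdigraph.whole G.toDigraph)) : (Sub.next d).1 = G.rot d.1 := by
  have h1 : Sub.step d = 1 :=
    le_antisymm (Sub.step_le one_pos trivial) (Sub.step_pos d)
  change (G.rot ^ Sub.step d) d.1 = _
  rw [h1, pow_one]

theorem dartFace_rev_rot (d : G.toDigraph.Dart) : dartFace (G.rot d).rev = dartFace d := by
  refine (Quot.sound ⟨⟨d, trivial⟩, rfl, ?_⟩).symm
  exact congrArg Sum.inl (Subtype.ext (by
    change (G.rot d).rev = (Sub.next _).1.rev
    rw [next_whole]))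

theorem dartFace_rev (d : G.toDigraph.Dart) : dartFace d.rev = dartFace (G.rot.symm d) := by
  rw [← dartFace_rev_rot (G.rot.symm d), Equiv.apply_symm_apply]

theorem base_mem_verts (d : G.toDigraph.Dart) : d.base ∈ (dartFace d).verts :=
  ⟨cornerAt d, rfl, rfl⟩

theorem head_mem_verts (d : G.toDigraph.Dart) : d.1.head ∈ (dartFace d).verts := by
  cases h : d.2 with
  | false => exact base_of_false h ▸ base_mem_verts d
  | true =>
    have h1 : d.rev.base = d.1.head := by simp [Dart.rev, Dart.base, h]
    rw [← h1, ← base_symm_rot d.rev]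
    have h2 := dartFace_rev d.rev
    rw [rev_rev] at h2
    rw [h2]
    exact base_mem_verts _

/-- The faces that are connected in the dual graph by the edges dual to those in `X`. -/
def dualSetoid (X : Set G.toDigraph.Edge) : Setoid G.Face :=
  Relation.EqvGen.setoid fun f g => ∃ d : G.toDigraph.Dart, d.1 ∈ X ∧ dartFace d = f ∧ dartFace d.rev = g

theorem dualSetoid_dart {X : Set G.toDigraph.Edge} {d : G.toDigraph.Dart} (h : d.1 ∈ X) :
    dualSetoid X (dartFace d) (dartFace d.rev) := .rel _ _ ⟨d, h, rfl, rfl⟩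

theorem dualSetoid_le {X : Set G.toDigraph.Edge} {r : Setoid G.Face}
    (h : ∀ d : G.toDigraph.Dart, d.1 ∈ X → r (dartFace d) (dartFace d.rev)) :
    dualSetoid X ≤ r :=
  Setoid.eqvGen_le fun _ _ ⟨d, hd, hf, hg⟩ => hf ▸ hg ▸ h d hd

theorem dualSetoid_mono {X Y : Set G.toDigraph.Edge} (h : X ⊆ Y) : dualSetoid X ≤ dualSetoid Y :=
  dualSetoid_le fun _ hd => dualSetoid_dart (h hd)

theorem mem_dualComponent {H : G.Sub} {f g : G.Face} :
    g ∈ dualComponent H f ↔ dualSetoid H.edgesᶜ f g := by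
  have hadj : ∀ f g, DualAdj H f g ↔
      ∃ d : G.toDigraph.Dart, d.1 ∈ H.edgesᶜ ∧ dartFace d = f ∧ dartFace d.rev = g := by
    intro f g
    constructor
    · rintro ⟨e, he, ⟨h1, h2⟩ | ⟨h1, h2⟩⟩
      · exact ⟨(e, true), he, h1, h2⟩
      · exact ⟨(e, false), he, h2, h1⟩
    · rintro ⟨d, hd, h1, h2⟩
      rcases rev_cases d with ⟨h3, h4⟩ | ⟨h3, h4⟩
      · exact ⟨d.1, hd, Or.inl ⟨h3 ▸ h1, h4 ▸ h2⟩⟩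
      · exact ⟨d.1, hd, Or.inr ⟨h4 ▸ h2, h3 ▸ h1⟩⟩
  constructor
  · intro h
    change Relation.ReflTransGen _ _ _ at h
    induction h with
    | refl => exact Setoid.refl' _ _
    | tail _ h ih => exact Setoid.trans' _ ih (.rel _ _ ((hadj _ _).1 h))
  · intro h
    have : Std.Symm (DualAdj H) := ⟨fun f g ⟨e, he, h⟩ => ⟨e, he, h.symm⟩⟩
    change Relation.ReflTransGen _ _ _
    induction h with
    | rel _ _ h => exact .single ((hadj _ _).2 h)
    | refl => exact .refl
    | symm _ _ _ ih => exact Std.Symm.symm _ _ ih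
    | trans _ _ _ _ _ h1 h2 => exact h1.trans h2

theorem dualComponent_eq_iff {H : G.Sub} {f g : G.Face} :
    dualComponent H f = dualComponent H g ↔ dualSetoid H.edgesᶜ f g := by
  constructor
  · intro h
    exact mem_dualComponent.1 (h ▸ mem_dualComponent.2 (Setoid.refl' _ g))
  · intro h
    ext x
    rw [mem_dualComponent, mem_dualComponent]
    exact ⟨Setoid.trans' _ (Setoid.symm' _ h), Setoid.trans' _ h⟩

theorem self_mem_dualComponent (H : G.Sub) (f : G.Face) : f ∈ dualComponent H f :=
  mem_dualComponent.2 (Setoid.refl' _ f)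

theorem dualComponent_anti {H K : G.Sub} (h : H.edges ⊆ K.edges) (f : G.Face) :
    dualComponent K f ⊆ dualComponent H f := fun _ hg =>
  mem_dualComponent.2 (dualSetoid_mono (Set.compl_subset_compl.2 h) (mem_dualComponent.1 hg))

/-- A set that is closed under dual adjacency contains the components it meets. -/
theorem dualComponent_subset {H : G.Sub} {R : Set G.Face} {f : G.Face} (hf : f ∈ R)
    (hR : ∀ d : G.toDigraph.Dart, d.1 ∉ H.edges → dartFace d ∈ R → dartFace d.rev ∈ R) :
    dualComponent H f ⊆ R := by
  intro g hg
  have : dualSetoid H.edgesᶜ ≤ Setoid.ker (· ∈ R) := dualSetoid_le fun d hd => by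
    refine propext ⟨hR d hd, fun h => ?_⟩
    have := hR d.rev hd h
    rwa [rev_rev] at this
  have h := this (mem_dualComponent.1 hg)
  exact cast (show (f ∈ R) = (g ∈ R) from h) hf

/-- If, of all edges at a vertex, only one may have its two sides not related, they are. -/
theorem rel_rev_of_rot {r : Setoid G.Face} {d : G.toDigraph.Dart}
    (h : ∀ d' : G.toDigraph.Dart, d'.base = d.base → d' ≠ d → r (dartFace d') (dartFace d'.rev)) :
    r (dartFace d) (dartFace d.rev) := by
  -- Turning around the vertex from one side of `d`, only other edges are crossed until the other
  -- side of `d` is reached.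
  have key : ∀ k : ℕ, r (dartFace d) (dartFace ((G.rot ^ k) d)) := by
    intro k
    induction k with
    | zero => exact Setoid.refl' _ _
    | succ k ih =>
      by_cases hk : (G.rot ^ (k + 1)) d = d
      · rw [hk]
      · have h1 := h _ (base_rot_pow (k + 1) d) hk
        rw [pow_succ', Equiv.Perm.mul_apply] at h1 ⊢
        rw [dartFace_rev_rot] at h1
        exact Setoid.trans' _ ih (Setoid.symm' _ h1)
  rw [dartFace_rev]
  obtain ⟨k, hk⟩ := exists_rot_pow (d := d) (d' := G.rot.symm d) (base_symm_rot d).symm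
  exact hk ▸ key k

/-- All faces inside a corner of `H` are in one component of the dual without the edges of `H`. -/
theorem dualSetoid_rot_pow {H : G.Sub} (d : H.Dart) {j : ℕ} (hj : j < Sub.step d) :
    dualSetoid H.edgesᶜ (dartFace d.1) (dartFace ((G.rot ^ j) d.1)) := by
  induction j with
  | zero => exact Setoid.refl' _ _
  | succ j ih =>
    refine Setoid.trans' _ (ih (by omega)) (Setoid.symm' _ ?_)
    have := dualSetoid_dart (X := H.edgesᶜ) (Sub.rot_pow_notMem (Nat.succ_pos j) hj)
    rw [pow_succ', Equiv.Perm.mul_apply, dartFace_rev_rot] at this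
    rwa [pow_succ', Equiv.Perm.mul_apply]

/-- The last corner of `G` inside the corner at `d` comes just before `next d`, and from there the
boundary walk in `G` continues with `rev (next d)`. So a boundary walk of `H` stays in one
component. -/
theorem dualSetoid_next {H : G.Sub} (d : H.Dart) :
    dualSetoid H.edgesᶜ (dartFace d.1) (dartFace (Sub.next d).1.rev) := by
  have h := dualSetoid_rot_pow d (j := Sub.step d - 1) (by have := Sub.step_pos d; omega)
  have h2 : (Sub.next d).1 = G.rot ((G.rot ^ (Sub.step d - 1)) d.1) := by
    change (G.rot ^ _) _ = _
    rw [← Equiv.Perm.mul_apply, ← pow_succ', Nat.sub_add_cancel (Sub.step_pos d)]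
  rwa [h2, dartFace_rev_rot]

/-- The component of the dual in which a corner between darts of `H` lies. -/
noncomputable def cornerClass {H : G.Sub} : H.Corner → Option (Quotient (dualSetoid H.edgesᶜ))
  | Sum.inl d => some (Quotient.mk _ (dartFace d.1))
  | Sum.inr _ => none

theorem cornerClass_eq {H : G.Sub} {c c' : H.Corner} (h : Sub.faceOf c = Sub.faceOf c') :
    cornerClass c = cornerClass c' := by
  have hs : ∀ c c' : H.Corner, Sub.Consecutive c c' → cornerClass c = cornerClass c' := by
    rintro _ _ ⟨d, rfl, rfl⟩
    exact congrArg some (Quotient.sound (dualSetoid_next d))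
  exact congrArg (Quot.lift cornerClass hs) h

theorem dualSetoid_of_faceOf_eq {H : G.Sub} {d d' : H.Dart}
    (h : Sub.faceOf (Sum.inl d : H.Corner) = Sub.faceOf (Sum.inl d')) :
    dualSetoid H.edgesᶜ (dartFace d.1) (dartFace d'.1) :=
  Quotient.exact (Option.some.inj (cornerClass_eq h))

/-- This is the link between boundary walks and dual components: a frame is obtained from any dart
of `H` at a face of the desired component. -/
theorem subfaces_faceOf {H : G.Sub} (d : H.Dart) :
    (Sub.faceOf (Sum.inl d : H.Corner)).subfaces = dualComponent H (dartFace d.1) := by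
  ext g
  constructor
  · rintro ⟨c | v, hc, c', hc', hg⟩
    · obtain ⟨j, hj, rfl⟩ := hc'
      rw [mem_dualComponent] at hg ⊢
      exact Setoid.trans' _ (dualSetoid_of_faceOf_eq hc.symm)
        (Setoid.trans' _ (dualSetoid_rot_pow c hj) hg)
    · exact absurd (cornerClass_eq hc) (by simp [cornerClass])
  · intro hg
    exact ⟨Sum.inl d, rfl, cornerAt d.1, ⟨0, Sub.step_pos d, rfl⟩, hg⟩

end EmbeddedDigraph

namespace EmbeddedDigraph

open Digraph

variable {V : Type u} {G : EmbeddedDigraph V}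

/-! ### Backward closed subgraphs -/

theorem mem_of_reaches {H : G.Sub} (hH : H.IsBackwardClosed) {u v : V} (h : G.Reaches u v)
    (hv : v ∈ H.verts) : u ∈ H.verts := by
  induction h using Relation.ReflTransGen.head_induction_on with
  | refl => exact hv
  | head hab _ ih => exact H.tail_mem _ (hH ⟨(_, _), hab⟩ ih)

/-- Every vertex outside a subgraph that contains the source has an ingoing edge. -/
theorem exists_head_eq {H : G.Sub} {s : V} (hs : ∀ v, G.Reaches s v) (hsH : s ∈ H.verts) {w : V}
    (hw : w ∉ H.verts) : ∃ e : G.toDigraph.Edge, e.head = w := by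
  rcases Relation.ReflTransGen.cases_tail (hs w) with rfl | ⟨x, -, hx⟩
  · exact absurd hsH hw
  · exact ⟨⟨(x, w), hx⟩, rfl⟩

variable [Finite V]

/-! ### Counting the components of the dual graph -/

instance : Finite G.Face := inferInstanceAs (Finite (Quot _))

theorem card_quotient_le_insert (X : Set G.toDigraph.Edge) (e : G.toDigraph.Edge) :
    Nat.card (Quotient (dualSetoid X)) ≤ Nat.card (Quotient (dualSetoid (insert e X))) + 1 := by
  classical
  set a := dartFace (e, true) with ha
  set b := dartFace (e, false) with hb
  let A : G.Face → Prop := fun f => dualSetoid X f a ∨ dualSetoid X f b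
  have hA : ∀ {f g}, dualSetoid X f g → A g → A f := fun h hg =>
    hg.imp (Setoid.trans' _ h) (Setoid.trans' _ h)
  let r : Setoid G.Face :=
    { r := fun f g => dualSetoid X f g ∨ (A f ∧ A g)
      iseqv := by
        refine ⟨fun f => .inl (Setoid.refl' _ f), fun h => h.imp (Setoid.symm' _) And.symm, ?_⟩
        rintro f g h (h1 | h1) (h2 | h2)
        · exact .inl (Setoid.trans' _ h1 h2)
        · exact .inr ⟨hA h1 h2.1, h2.2⟩
        · exact .inr ⟨h1.1, hA (Setoid.symm' _ h2) h1.2⟩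
        · exact .inr ⟨h1.1, h2.2⟩ }
  have hr : dualSetoid (insert e X) ≤ r := by
    refine dualSetoid_le fun d hd => ?_
    rcases hd with rfl | hd
    · right
      rcases rev_cases d with ⟨h1, h2⟩ | ⟨h1, h2⟩
      · exact ⟨.inl (h1 ▸ Setoid.refl' _ _), .inr (h2 ▸ Setoid.refl' _ _)⟩
      · exact ⟨.inr (h1 ▸ Setoid.refl' _ _), .inl (h2 ▸ Setoid.refl' _ _)⟩
    · exact .inl (dualSetoid_dart hd)
  let φ : Quotient (dualSetoid X) → Quotient (dualSetoid (insert e X)) :=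
    Quotient.map' id fun _ _ h => dualSetoid_mono (Set.subset_insert e X) h
  -- Only the classes of `a` and `b` can be merged; sending the former to `none` restores
  -- injectivity.
  let ψ : Quotient (dualSetoid X) → Option (Quotient (dualSetoid (insert e X))) :=
    fun q => if q = Quotient.mk _ a then none else some (φ q)
  have hψ : Function.Injective ψ := by
    intro p q hpq
    by_cases hp : p = Quotient.mk _ a <;> by_cases hq : q = Quotient.mk _ a
    · rw [hp, hq]
    · simp [ψ, hp, hq] at hpq
    · simp [ψ, hp, hq] at hpq
    · simp only [ψ, hp, hq, if_false, Option.some.injEq] at hpq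
      induction p using Quotient.inductionOn with | _ f
      induction q using Quotient.inductionOn with | _ g
      rcases hr (Quotient.exact hpq) with h | ⟨h1 | h1, h2 | h2⟩
      · exact Quotient.sound h
      · exact absurd (Quotient.sound h1) hp
      · exact absurd (Quotient.sound h1) hp
      · exact absurd (Quotient.sound h2) hq
      · exact Quotient.sound (Setoid.trans' _ h1 (Setoid.symm' _ h2))
  have := Nat.card_le_card_of_injective ψ hψ
  rwa [Finite.card_option] at this

theorem card_quotient_le_union (X Y : Set G.toDigraph.Edge) :
    Nat.card (Quotient (dualSetoid X)) ≤ Nat.card (Quotient (dualSetoid (X ∪ Y))) + Y.ncard := by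
  induction Y, Y.toFinite using Set.Finite.induction_on with
  | empty => simp
  | @insert e Y he hY ih =>
    rw [Set.ncard_insert_of_notMem he hY, Set.union_insert]
    have := card_quotient_le_insert (X ∪ Y) e
    omega

theorem wellFounded_swap_transGen (hac : G.toDigraph.IsAcyclic) :
    WellFounded (Function.swap (Relation.TransGen G.Adj)) := by
  have : Std.Irrefl (Function.swap (Relation.TransGen G.Adj)) := ⟨hac⟩
  have : IsTrans V (Function.swap (Relation.TransGen G.Adj)) := ⟨fun _ _ _ h1 h2 => h2.trans h1⟩
  exact Finite.wellFounded_of_trans_of_irrefl _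

/-- Adding vertices with all their ingoing edges increases the number of components of the dual by
at most the number of new edges minus the number of new vertices. -/
theorem card_quotient_add_le {H K : G.Sub} (hac : G.toDigraph.IsAcyclic) {s : V}
    (hs : ∀ v, G.Reaches s v) (hsH : s ∈ H.verts) (hK : K.IsBackwardClosed) :
    Nat.card (Quotient (dualSetoid K.edgesᶜ)) + (K.verts \ H.verts).ncard ≤
      Nat.card (Quotient (dualSetoid H.edgesᶜ)) + (K.edges \ H.edges).ncard := by
  classical
  -- One ingoing edge per missing vertex: by acyclicity these edges form a forest rooted in `H`, and
  -- allowing its dual edges to be crossed merges nothing further.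
  choose p hp using fun w : {w // w ∉ H.verts} => exists_head_eq hs hsH w.2
  let P : Set G.toDigraph.Edge := {e | ∃ w : {w // w ∉ H.verts}, w.1 ∈ K.verts ∧ p w = e}
  have hPsub : P ⊆ K.edges \ H.edges := by
    rintro _ ⟨w, hw, rfl⟩
    exact ⟨hK _ (by rw [hp]; exact hw), fun h => w.2 (by rw [← hp w]; exact H.head_mem _ h)⟩
  have hPcard : P.ncard = (K.verts \ H.verts).ncard := by
    symm
    refine Set.ncard_congr (fun w hw => p ⟨w, hw.2⟩) ?_ ?_ ?_
    · exact fun w hw => ⟨⟨w, hw.2⟩, hw.1, rfl⟩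
    · intro a b ha hb hab
      have := congrArg Edge.head hab
      rwa [hp, hp] at this
    · rintro _ ⟨w, hw, rfl⟩
      exact ⟨w.1, ⟨hw, w.2⟩, rfl⟩
  have hrest : ((K.edges \ H.edges) \ P).ncard + P.ncard = (K.edges \ H.edges).ncard :=
    Set.ncard_sdiff_add_ncard_of_subset hPsub
  have h1 := card_quotient_le_union (G := G) K.edgesᶜ ((K.edges \ H.edges) \ P)
  set Y := K.edgesᶜ ∪ (K.edges \ H.edges) \ P with hY
  have hmemY : ∀ e, e ∉ H.edges → e ∉ P → e ∈ Y := by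
    intro e h1 h2
    by_cases h3 : e ∈ K.edges
    · exact .inr ⟨⟨h3, h1⟩, h2⟩
    · exact .inl h3
  -- Induction from the far ends of the forest. Around `w`, every edge other than `p w` is either in
  -- `Y` or a forest edge to a successor of `w`, so its sides are already connected.
  have hpar : ∀ w (hw : w ∉ H.verts), ∀ d : G.toDigraph.Dart, d.1 = p ⟨w, hw⟩ →
      dualSetoid Y (dartFace d) (dartFace d.rev) := by
    intro w
    induction w using (wellFounded_swap_transGen hac).induction with
    | _ w ih =>
      intro hw
      have hd0 : dualSetoid Y (dartFace (p ⟨w, hw⟩, false)) (dartFace (p ⟨w, hw⟩, true)) := by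
        refine rel_rev_of_rot (d := (p ⟨w, hw⟩, false)) fun d hd hne => ?_
        rw [base_of_false (d := (p ⟨w, hw⟩, false)) rfl, hp] at hd
        rcases hd2 : d.2 with _ | _
        · rw [base_of_false hd2] at hd
          change _ = w at hd
          refine dualSetoid_dart (hmemY _ (fun h => hw (hd ▸ H.head_mem _ h)) ?_)
          rintro ⟨w', -, h⟩
          have h2 : w' = ⟨w, hw⟩ := Subtype.ext (by rw [← hp w', h, hd])
          exact hne (Prod.ext (by rw [← h, h2]) hd2)
        · rw [base_of_true hd2] at hd
          change _ = w at hd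
          have hnH : d.1 ∉ H.edges := fun h => hw (hd ▸ H.tail_mem _ h)
          by_cases hdP : d.1 ∈ P
          · obtain ⟨w', hw', h⟩ := hdP
            refine ih w'.1 (Relation.TransGen.single ?_) w'.2 d h.symm
            have h3 := d.1.2
            change G.Adj d.1.tail d.1.head at h3
            rwa [hd, ← h, hp] at h3
          · exact dualSetoid_dart (hmemY _ hnH hdP)
      intro d hd
      rcases rev_cases d with ⟨h3, h4⟩ | ⟨h3, h4⟩
      · rw [h4, h3, hd]; exact Setoid.symm' _ hd0
      · rw [h4, h3, hd]; exact hd0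
  have hle : dualSetoid H.edgesᶜ ≤ dualSetoid Y := by
    refine dualSetoid_le fun d hd => ?_
    by_cases hdP : d.1 ∈ P
    · obtain ⟨w, hw, h⟩ := hdP
      exact hpar w.1 w.2 d h.symm
    · exact dualSetoid_dart (hmemY _ hd hdP)
  have h2 : Nat.card (Quotient (dualSetoid Y)) ≤ Nat.card (Quotient (dualSetoid H.edgesᶜ)) :=
    Nat.card_le_card_of_surjective (Quotient.map' id fun _ _ h => hle h)
      (Quotient.ind fun f => ⟨Quotient.mk _ f, rfl⟩)
  omega

theorem subsingleton_of_isEmpty_edge [IsEmpty G.toDigraph.Edge] {s : V}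
    (hs : ∀ v, G.Reaches s v) : Subsingleton G.Face := by
  have hV : ∀ v, v = s := fun v => by
    rcases Relation.ReflTransGen.cases_tail (hs v) with h | ⟨x, -, hx⟩
    · exact h
    · exact isEmptyElim (⟨(x, v), hx⟩ : G.toDigraph.Edge)
  refine ⟨fun f g => ?_⟩
  induction f using Quot.ind with | _ c
  induction g using Quot.ind with | _ c'
  rcases c with d | v
  · exact isEmptyElim d.1.1
  · rcases c' with d | v'
    · exact isEmptyElim d.1.1
    · exact congrArg _ (congrArg Sum.inr (Subtype.ext ((hV _).trans (hV _).symm)))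

theorem exists_dartFace_eq {s : V} (hs : ∀ v, G.Reaches s v) (e : G.toDigraph.Edge) (f : G.Face) :
    ∃ d : G.toDigraph.Dart, dartFace d = f := by
  induction f using Quot.ind with | _ c
  rcases c with d | ⟨v, -, hv⟩
  · exact ⟨d.1, rfl⟩
  · exfalso
    have hsv : s = v := by
      rcases Relation.ReflTransGen.cases_tail (hs v) with h | ⟨x, -, hx⟩
      · exact h.symm
      · exact absurd rfl (hv ⟨(x, v), hx⟩ trivial).2
    subst hsv
    rcases Relation.ReflTransGen.cases_head (hs e.tail) with h | ⟨x, hx, -⟩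
    · exact (hv e trivial).1 h.symm
    · exact absurd rfl (hv ⟨(s, x), hx⟩ trivial).1

/-- The dual graph is connected. -/
theorem dualSetoid_univ {s : V} (hs : ∀ v, G.Reaches s v) (f g : G.Face) :
    dualSetoid Set.univ f g := by
  cases isEmpty_or_nonempty G.toDigraph.Edge with
  | inl h =>
    have := subsingleton_of_isEmpty_edge hs
    exact Subsingleton.elim f g ▸ Setoid.refl' _ f
  | inr h =>
    obtain ⟨e0⟩ := h
    have hrev : ∀ d : G.toDigraph.Dart, dualSetoid Set.univ (dartFace d) (dartFace d.rev) :=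
      fun d => dualSetoid_dart trivial
    have hrot : ∀ (d : G.toDigraph.Dart) (k : ℕ),
        dualSetoid Set.univ (dartFace d) (dartFace ((G.rot ^ k) d)) := by
      intro d k
      induction k with
      | zero => exact Setoid.refl' _ _
      | succ k ih =>
        have h1 := hrev (G.rot ((G.rot ^ k) d))
        rw [dartFace_rev_rot] at h1
        rw [pow_succ', Equiv.Perm.mul_apply]
        exact Setoid.trans' _ ih (Setoid.symm' _ h1)
    have hbase : ∀ d d' : G.toDigraph.Dart, d.base = d'.base →
        dualSetoid Set.univ (dartFace d) (dartFace d') := by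
      intro d d' h
      obtain ⟨k, rfl⟩ := exists_rot_pow h
      exact hrot d k
    obtain ⟨d0, hd0⟩ : ∃ d : G.toDigraph.Dart, d.base = s := by
      rcases Relation.ReflTransGen.cases_head (hs e0.tail) with h | ⟨x, hx, -⟩
      · exact ⟨(e0, true), h.symm⟩
      · exact ⟨(⟨(s, x), hx⟩, true), rfl⟩
    have key : ∀ v, G.Reaches s v → ∀ d : G.toDigraph.Dart, d.base = v →
        dualSetoid Set.univ (dartFace d0) (dartFace d) := by
      intro v hv
      induction hv with
      | refl => exact fun d hd => hbase _ _ (hd0.trans hd.symm)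
      | @tail x y _ hxy ih =>
        intro d hd
        let e : G.toDigraph.Edge := ⟨(x, y), hxy⟩
        exact Setoid.trans' _ (ih (e, true) rfl)
          (Setoid.trans' _ (hrev (e, true)) (hbase (e, false) d hd.symm))
    obtain ⟨d, rfl⟩ := exists_dartFace_eq hs e0 f
    obtain ⟨d', rfl⟩ := exists_dartFace_eq hs e0 g
    exact Setoid.trans' _ (Setoid.symm' _ (key _ (hs _) d rfl)) (key _ (hs _) d' rfl)

/-- Euler's formula of a connected plane digraph. -/
theorem euler (hpl : G.IsPlane) {s : V} (hs : ∀ v, G.Reaches s v) :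
    Nat.card V + Nat.card G.Face = Nat.card G.toDigraph.Edge + 2 := by
  have hreach : ∀ v, G.toDigraph.toSimpleGraphInclusive.Reachable s v := by
    intro v
    induction hs v with
    | refl => exact .refl _
    | @tail x y _ hxy ih =>
      by_cases h : x = y
      · exact h ▸ ih
      · exact ih.trans (SimpleGraph.Adj.reachable ⟨h, Or.inl hxy⟩)
  have : Nat.card G.toDigraph.toSimpleGraphInclusive.ConnectedComponent = 1 := by
    rw [Nat.card_eq_one_iff_unique]
    refine ⟨⟨fun a b => ?_⟩, ⟨SimpleGraph.connectedComponentMk _ s⟩⟩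
    induction a using SimpleGraph.ConnectedComponent.ind with | _ a
    induction b using SimpleGraph.ConnectedComponent.ind with | _ b
    exact SimpleGraph.ConnectedComponent.sound ((hreach a).symm.trans (hreach b))
  have h := hpl
  rw [IsPlane, this] at h
  exact h

/-- Euler's formula for a backward closed subgraph that contains the source, with the components
of the dual graph as faces. -/
theorem card_quotient_add_card_verts (hpl : G.IsPlane) (hac : G.toDigraph.IsAcyclic) {s : V}
    (hs : ∀ v, G.Reaches s v) {H : G.Sub} (hsH : s ∈ H.verts) (hH : H.IsBackwardClosed) :
    Nat.card (Quotient (dualSetoid H.edgesᶜ)) + H.verts.ncard = H.edges.ncard + 2 := by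
  -- The inequalities for the steps from `{s}` to `H` and from `H` to `G` add up to Euler's formula
  -- for `G`, which forces equality in both.
  let S : G.Sub := ⟨{s}, ∅, fun _ h => h.elim, fun _ h => h.elim⟩
  have hW : (Subdigraph.whole G.toDigraph).IsBackwardClosed := fun _ _ => trivial
  have h1 := card_quotient_add_le hac hs (H := S) rfl hH
  have h2 := card_quotient_add_le hac hs hsH hW
  have h3 := euler hpl hs
  have hSq : Nat.card (Quotient (dualSetoid (G := G) S.edgesᶜ)) ≤ 1 := by
    have : S.edgesᶜ = Set.univ := Set.compl_empty
    rw [this]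
    have : Subsingleton (Quotient (dualSetoid (G := G) Set.univ)) :=
      ⟨Quotient.ind₂ fun f g => Quotient.sound (dualSetoid_univ hs f g)⟩
    exact Finite.card_le_one_iff_subsingleton.2 this
  have hWq : Nat.card G.Face ≤
      Nat.card (Quotient (dualSetoid (Subdigraph.whole G.toDigraph).edgesᶜ)) := by
    refine Nat.card_le_card_of_injective (Quotient.mk _) fun f g h => ?_
    exact dualSetoid_le (r := ⊥) (fun d hd => absurd trivial hd) (Quotient.exact h)
  have h4 : (H.verts \ S.verts).ncard + 1 = H.verts.ncard :=
    Set.ncard_sdiff_singleton_add_one hsH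
  have h5 : H.edges \ S.edges = H.edges := Set.sdiff_empty
  have h6 : (Set.univ \ H.verts).ncard + H.verts.ncard = Nat.card V := by
    rw [← Set.ncard_univ]
    exact Set.ncard_sdiff_add_ncard_of_subset (Set.subset_univ _)
  have h7 : (Set.univ \ H.edges).ncard + H.edges.ncard = Nat.card G.toDigraph.Edge := by
    rw [← Set.ncard_univ]
    exact Set.ncard_sdiff_add_ncard_of_subset (Set.subset_univ _)
  change _ + (Set.univ \ H.verts).ncard ≤ _ + (Set.univ \ H.edges).ncard at h2
  rw [h5] at h1
  omega

/-! ### Target corners -/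

/-- The corner that starts with the dart `d` lies between two ingoing edges. -/
def IsTarget {H : G.Sub} (d : H.Dart) : Prop := d.1.2 = false ∧ (Sub.next d).1.2 = false

/-- The target corners of a subgraph, given by their first darts. -/
def targets (H : G.Sub) : Set G.toDigraph.Dart := {d | ∃ h : d.1 ∈ H.edges, IsTarget (H := H) ⟨d, h⟩}

theorem snd_of_mem_targets {H : G.Sub} {d : G.toDigraph.Dart} (h : d ∈ targets H) : d.2 = false :=
  h.2.1

theorem base_of_mem_targets {H : G.Sub} {d : G.toDigraph.Dart} (h : d ∈ targets H) :
    d.base = d.1.head := base_of_false h.2.1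

theorem snd_cases (b : Bool) : b = false ∨ b = true := by cases b <;> simp

/-- The boundary of a face, followed from any dart, leads along edges directed forwards to
a target corner. -/
theorem exists_isTarget (hac : G.toDigraph.IsAcyclic) {H : G.Sub} (d : H.Dart) :
    ∃ t : H.Dart, IsTarget t ∧ Sub.faceOf (Sum.inl d : H.Corner) = Sub.faceOf (Sum.inl t) ∧
      G.Reaches d.1.1.head t.1.base := by
  suffices h : ∀ v, ∀ d : H.Dart, d.1.1.head = v → ∃ t : H.Dart, IsTarget t ∧
      Sub.faceOf (Sum.inl d : H.Corner) = Sub.faceOf (Sum.inl t) ∧ G.Reaches v t.1.base by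
    exact h _ d rfl
  intro v
  induction v using (wellFounded_swap_transGen hac).induction with
  | _ v ih =>
    -- An edge of the boundary that leaves `v` moves the search to its head, where the induction
    -- hypothesis applies.
    have step : ∀ d : H.Dart, d.1.1.tail = v → ∀ d' : H.Dart,
        Sub.faceOf (Sum.inl d' : H.Corner) = Sub.faceOf (Sum.inl d) → ∃ t : H.Dart, IsTarget t ∧
        Sub.faceOf (Sum.inl d' : H.Corner) = Sub.faceOf (Sum.inl t) ∧ G.Reaches v t.1.base := by
      intro d hd d' hd'
      have hadj : G.Adj v d.1.1.head := hd ▸ d.1.1.2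
      obtain ⟨t, h1, h2, h3⟩ := ih _ (.single hadj) d rfl
      exact ⟨t, h1, hd'.trans h2, .head hadj h3⟩
    intro d hd
    rcases snd_cases d.1.2 with h | h
    · rcases snd_cases (Sub.next d).1.2 with h' | h'
      · refine ⟨d, ⟨h, h'⟩, rfl, ?_⟩
        rw [base_of_false h, hd]
        exact .refl
      · refine step (Sub.rev (Sub.next d)) ?_ d (Quot.sound ⟨d, rfl, rfl⟩)
        rw [← hd, ← base_of_false h, ← Sub.base_next, base_of_true h']
        rfl
    -- For an outgoing dart the walk is followed backwards: the preceding corner `c` sits at the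
    -- head of its edge.
    · obtain ⟨c, hc⟩ := Sub.next_surjective (Sub.rev d)
      have hrev : d = Sub.rev (Sub.next c) := by
        rw [hc]
        exact Subtype.ext (rev_rev d.1).symm
      have hface : Sub.faceOf (Sum.inl c : H.Corner) = Sub.faceOf (Sum.inl d) :=
        Quot.sound ⟨c, rfl, congrArg Sum.inl hrev⟩
      have h2 : (Sub.rev d).1.2 = false := by
        change (!d.1.2) = false
        simp [h]
      have hbase : c.1.base = v := by
        rw [← Sub.base_next, hc, base_of_false h2, ← hd]
        rfl
      rcases snd_cases c.1.2 with h' | h'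
      · refine ⟨c, ⟨h', by rw [hc, h2]⟩, hface.symm, ?_⟩
        rw [hbase]
        exact .refl
      · exact step c (by rw [← hbase, base_of_true h']) d hface.symm

/-- Each step `d ↦ rev (next d)` of the walk runs along one edge. It maps the corners that end with
an ingoing edge bijectively to those that start with an outgoing one, and the two kinds in question
are the two differences of these sets. -/
theorem ncard_sources_eq_ncard_targets {H : G.Sub} (F : H.Face) :
    F.sources.ncard = F.targets.ncard := by
  let A : Set H.Dart := {d | Sub.faceOf (Sum.inl d) = F ∧ d.1.2 = true}
  let B : Set H.Dart := {d | Sub.faceOf (Sum.inl d) = F ∧ (Sub.next d).1.2 = false}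
  have hface : ∀ d : H.Dart, Sub.faceOf (Sum.inl (Sub.rev (Sub.next d)) : H.Corner) =
      Sub.faceOf (Sum.inl d) := fun d => (Quot.sound ⟨d, rfl, rfl⟩).symm
  have hrev : ∀ d : H.Dart, Sub.rev (Sub.rev d) = d := fun d => Subtype.ext (rev_rev d.1)
  have hBA : B.ncard = A.ncard := by
    refine Set.ncard_congr (fun d _ => Sub.rev (Sub.next d)) ?_ ?_ ?_
    · exact fun d hd => ⟨(hface d).trans hd.1, congrArg not hd.2⟩
    · intro a b _ _ hab
      apply Sub.next_injective
      rw [← hrev (Sub.next a), hab, hrev]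
    · intro d hd
      obtain ⟨c, hc⟩ := Sub.next_surjective (Sub.rev d)
      have h1 : Sub.rev (Sub.next c) = d := by rw [hc, hrev]
      refine ⟨c, ⟨?_, ?_⟩, h1⟩
      · rw [← hface, h1]
        exact hd.1
      · rw [hc]
        exact congrArg not hd.2
  have h1 : F.sources = A \ B := by
    ext d
    constructor
    · exact fun ⟨h1, h2, h3⟩ => ⟨⟨h1, h2⟩, fun h => by simp [h.2] at h3⟩
    · exact fun ⟨⟨h1, h2⟩, h3⟩ => ⟨h1, h2, Bool.eq_true_of_not_eq_false fun h => h3 ⟨h1, h⟩⟩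
  have h2 : F.targets = B \ A := by
    ext d
    constructor
    · exact fun ⟨h1, h2, h3⟩ => ⟨⟨h1, h3⟩, fun h => by simp [h.2] at h2⟩
    · exact fun ⟨⟨h1, h2⟩, h3⟩ => ⟨h1, Bool.eq_false_of_not_eq_true fun h => h3 ⟨h1, h⟩, h2⟩
  have h3 := Set.ncard_inter_add_ncard_sdiff_eq_ncard A B
  have h4 := Set.ncard_inter_add_ncard_sdiff_eq_ncard B A
  rw [Set.inter_comm] at h4
  rw [h1, h2]
  omega

theorem hasAlternationNumber_of_ncard_le (hac : G.toDigraph.IsAcyclic) {H : G.Sub} (d : H.Dart)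
    (h : (targets H ∩ dartFace ⁻¹' dualComponent H (dartFace d.1)).ncard ≤ 2) :
    (Sub.faceOf (Sum.inl d : H.Corner)).HasAlternationNumber 2 ∨
      (Sub.faceOf (Sum.inl d : H.Corner)).HasAlternationNumber 4 := by
  set F := Sub.faceOf (Sum.inl d : H.Corner) with hF
  have hle : F.targets.ncard ≤ 2 := by
    refine le_trans ?_ h
    refine Set.ncard_le_ncard_of_injOn Subtype.val ?_ Subtype.val_injective.injOn
    rintro t ⟨h1, h2⟩
    exact ⟨⟨t.2, h2⟩, mem_dualComponent.2 (dualSetoid_of_faceOf_eq (hF.symm.trans h1.symm))⟩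
  have hpos : 0 < F.targets.ncard := by
    obtain ⟨t, ht, h1, -⟩ := exists_isTarget hac d
    exact (Set.ncard_pos).2 ⟨t, h1.symm, ht⟩
  have hs := ncard_sources_eq_ncard_targets F
  rcases (by omega : F.targets.ncard = 1 ∨ F.targets.ncard = 2) with h1 | h1
  · exact .inl ⟨1, rfl, hs.trans h1, h1⟩
  · exact .inr ⟨2, rfl, hs.trans h1, h1⟩

/-! ### Target corners at new vertices -/

/-- The target corners of `K` at vertices outside `H`. -/
def newTargets (H K : G.Sub) : Set G.toDigraph.Dart := {d | d ∈ targets K ∧ d.base ∉ H.verts}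

/-- Both edges of such a corner end in `H`, hence belong to `H` by backward closure, and no edge of
`H` lies between them. -/
theorem mem_targets_of_base_mem {H K : G.Sub} (hHK : H.edges ⊆ K.edges) (hH : H.IsBackwardClosed)
    {d : G.toDigraph.Dart} (hd : d ∈ targets K) (hb : d.base ∈ H.verts) : d ∈ targets H := by
  obtain ⟨h, h1, h2⟩ := hd
  have hdH : d.1 ∈ H.edges := hH _ (by rwa [← base_of_false h1])
  have hn : (Sub.next (⟨d, hHK hdH⟩ : K.Dart)).1.1 ∈ H.edges := by
    apply hH
    rw [← base_of_false h2, Sub.base_next]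
    exact hb
  exact ⟨hdH, h1, by rw [Sub.next_eq_of_le hHK hdH hn]; exact h2⟩

/-- The target corner reached from the head of the edge cannot sit in `H`, since backward closure
would then put the edge into `H`. -/
theorem exists_newTarget_of_dart (hac : G.toDigraph.IsAcyclic) {H K : G.Sub}
    (hH : H.IsBackwardClosed) {d : G.toDigraph.Dart} (hdK : d.1 ∈ K.edges) (hdH : d.1 ∉ H.edges) :
    ∃ t ∈ newTargets H K, dualSetoid K.edgesᶜ (dartFace d) (dartFace t) ∧
      G.Reaches d.1.head t.base := by
  obtain ⟨t, h1, h2, h3⟩ := exists_isTarget hac (⟨d, hdK⟩ : K.Dart)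
  exact ⟨t.1, ⟨⟨t.2, h1⟩, fun h => hdH (hH _ (mem_of_reaches hH h3 h))⟩,
    dualSetoid_of_faceOf_eq h2, h3⟩

/-- A component that changes has an edge of `K` outside `H` on its boundary. -/
theorem exists_newTarget (hac : G.toDigraph.IsAcyclic) {H K : G.Sub} (hHK : H.edges ⊆ K.edges)
    (hH : H.IsBackwardClosed) {g : G.Face} (hg : dualComponent K g ≠ dualComponent H g) :
    ∃ t ∈ newTargets H K, dualSetoid K.edgesᶜ g (dartFace t) := by
  by_contra! hno
  refine hg (Set.Subset.antisymm (dualComponent_anti hHK g)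
    (dualComponent_subset (self_mem_dualComponent K g) fun d hd hdg => ?_))
  rw [mem_dualComponent] at hdg ⊢
  by_cases hdK : d.1 ∈ K.edges
  · obtain ⟨t, h1, h2, -⟩ := exists_newTarget_of_dart hac hH hdK hd
    exact absurd (Setoid.trans' _ hdg h2) (hno t h1)
  · exact Setoid.trans' _ hdg (dualSetoid_dart hdK)

/-- Target corners are charged to their first edges. At a new vertex with an outgoing edge, some
ingoing edge is followed by an outgoing one and is not charged. -/
theorem ncard_newTargets_add_le {H K : G.Sub} {s : V} (hs : ∀ v, G.Reaches s v)
    (hsH : s ∈ H.verts) (hK : K.IsBackwardClosed) :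
    (newTargets H K).ncard + {w ∈ K.verts \ H.verts | ∃ e ∈ K.edges, e.tail = w}.ncard ≤
      (K.edges \ H.edges).ncard := by
  set W := {w ∈ K.verts \ H.verts | ∃ e ∈ K.edges, e.tail = w} with hW
  have hx : ∀ w : W, ∃ x : K.Dart, x.1.base = w.1 ∧ x.1.2 = false ∧ (Sub.next x).1.2 = true := by
    rintro ⟨w, ⟨hwK, hwH⟩, e, he, hew⟩
    by_contra! hno
    obtain ⟨e', he'⟩ := exists_head_eq hs hsH hwH
    have he'K : e' ∈ K.edges := hK _ (he' ▸ hwK)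
    have := Sub.next_induction (H := K) (P := fun x => x.1.base = w ∧ x.1.2 = false)
      (fun x hx => ⟨(Sub.base_next x).trans hx.1, Bool.eq_false_of_not_eq_true (hno x hx.1 hx.2)⟩)
      (d := ⟨(e', false), he'K⟩) (d' := ⟨(e, true), he⟩) (he'.trans hew.symm) ⟨he', rfl⟩
    exact absurd this.2 (by simp)
  choose x hx1 hx2 hx3 using hx
  have hinj : Set.InjOn Prod.fst (newTargets H K) := fun a ha b hb hab =>
    Prod.ext hab ((snd_of_mem_targets ha.1).trans (snd_of_mem_targets hb.1).symm)
  have hWc : (Set.range fun w : W => (x w).1.1).ncard = W.ncard := by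
    rw [← Set.image_univ, Set.ncard_image_of_injective, Set.ncard_univ]
    · rfl
    · intro a b hab
      have : (x a).1 = (x b).1 := Prod.ext hab ((hx2 a).trans (hx2 b).symm)
      exact Subtype.ext (by rw [← hx1 a, this, hx1 b])
  rw [← hinj.ncard_image, ← hWc, ← Set.ncard_union_eq]
  · refine Set.ncard_le_ncard ?_
    rintro e (⟨d, hd, rfl⟩ | ⟨w, rfl⟩)
    · exact ⟨hd.1.1, fun h => hd.2 (base_of_mem_targets hd.1 ▸ H.head_mem _ h)⟩
    · refine ⟨(x w).2, fun h => w.2.1.2 ?_⟩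
      rw [← hx1, base_of_false (hx2 w)]
      exact H.head_mem _ h
  · rw [Set.disjoint_left]
    rintro _ ⟨d, hd, rfl⟩ ⟨w, hw⟩
    obtain ⟨⟨h, h1, h2⟩, -⟩ := hd
    have : x w = ⟨d, h⟩ := Subtype.ext (Prod.ext hw ((hx2 w).trans h1.symm))
    have h3 := hx3 w
    rw [this, h2] at h3
    exact absurd h3 (by simp)

/-! ### Adding the backward closure of a face -/

theorem isBackwardClosed_bc_union (f : G.Face) {H : G.Sub} (hH : H.IsBackwardClosed) :
    ((bc f).union H).IsBackwardClosed := fun e he =>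
  he.imp ((Subdigraph.isLeast_backwardClosure _ _).1.1 e) (hH e)

theorem edges_subset_bc_union (f : G.Face) (H : G.Sub) : H.edges ⊆ ((bc f).union H).edges :=
  Set.subset_union_right

/-- A face is isolated in the dual graph without the edges of its backward closure. -/
theorem dualComponent_bc_union (f : G.Face) (H : G.Sub) :
    dualComponent ((bc f).union H) f = {f} := by
  refine Set.Subset.antisymm (dualComponent_subset rfl ?_)
    (Set.singleton_subset_iff.2 (self_mem_dualComponent _ f))
  intro d hd hdf
  refine absurd (Or.inl ⟨d.1.head, ?_, .refl⟩) hd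
  rw [← show dartFace d = f from hdf]
  exact head_mem_verts d

theorem eq_of_dualSetoid_bc_union {f g : G.Face} {H : G.Sub}
    (h : dualSetoid ((bc f).union H).edgesᶜ f g) : g = f := by
  have := mem_dualComponent.2 h
  rwa [dualComponent_bc_union] at this

/-- A vertex with a nonempty path to `f` has an outgoing edge in `bc f`, so a new sink is incident
to `f`. All its corners in `K` are targets, and the one that contains a corner of `f` lies in the
component `{f}`. -/
theorem ncard_sinks_le {f : G.Face} {H : G.Sub} {s : V} (hs : ∀ v, G.Reaches s v)
    (hsH : s ∈ H.verts) (hH : H.IsBackwardClosed) :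
    {w ∈ ((bc f).union H).verts \ H.verts | ¬ ∃ e ∈ ((bc f).union H).edges, e.tail = w}.ncard ≤
      {d ∈ newTargets H ((bc f).union H) | dartFace d = f}.ncard := by
  set K : G.Sub := (bc f).union H with hKdef
  have hK : K.IsBackwardClosed := isBackwardClosed_bc_union f hH
  refine le_trans (Set.ncard_le_ncard ?_) (Set.ncard_image_le (f := Dart.base))
  rintro w ⟨⟨hwK, hwH⟩, hsink⟩
  have hwf : w ∈ f.verts := by
    obtain ⟨v, hv, hwv⟩ := hwK.resolve_right hwH
    rcases Relation.ReflTransGen.cases_head hwv with rfl | ⟨y, hy, hyv⟩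
    · exact hv
    · exact absurd ⟨⟨(w, y), hy⟩, Or.inl ⟨v, hv, hyv⟩, rfl⟩ hsink
  obtain ⟨e, he⟩ := exists_head_eq hs hsH hwH
  have heK : e ∈ K.edges := hK _ (he ▸ hwK)
  obtain ⟨c, hcf, hcw⟩ := hwf
  rcases c with d | v
  · obtain ⟨x, hx, j, hj, hxj⟩ := Sub.exists_eq_rot_pow (H := K) (d := ⟨(e, false), heK⟩)
      (d' := d.1) (he.trans hcw.symm)
    have hxw : x.1.base = w := hx.trans hcw
    have hin : ∀ y : K.Dart, y.1.base = w → y.1.2 = false := fun y hy =>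
      Bool.eq_false_of_not_eq_true fun h => hsink ⟨y.1.1, y.2, by rw [← base_of_true h, hy]⟩
    refine ⟨x.1, ⟨⟨⟨x.2, hin x hxw, hin _ ((Sub.base_next x).trans hxw)⟩, hxw ▸ hwH⟩, ?_⟩, hxw⟩
    have h1 := dualSetoid_rot_pow x hj
    rw [hxj, show dartFace d.1 = f from hcf] at h1
    exact eq_of_dualSetoid_bc_union (Setoid.symm' _ h1)
  · exact absurd (he.trans hcw.symm) (v.2.2 e trivial).2

/-- After adding the backward closure of a face `f`, every component other than `{f}` has at most
one target corner at a new vertex. -/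
theorem newTargets_unique (hpl : G.IsPlane) (hac : G.toDigraph.IsAcyclic) {s : V}
    (hs : ∀ v, G.Reaches s v) {H : G.Sub} (hsH : s ∈ H.verts) (hH : H.IsBackwardClosed)
    {f g : G.Face} (hgf : g ≠ f) (hg : dualSetoid H.edgesᶜ f g) {d d' : G.toDigraph.Dart}
    (hd : d ∈ newTargets H ((bc f).union H)) (hd' : d' ∈ newTargets H ((bc f).union H))
    (hdf : dartFace d ≠ f) (hdd' : dualSetoid ((bc f).union H).edgesᶜ (dartFace d) (dartFace d')) :
    d = d' := by
  have hT := ncard_newTargets_add_le hs hsH (isBackwardClosed_bc_union f hH)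
  have hS := ncard_sinks_le (f := f) hs hsH hH
  have hHK := edges_subset_bc_union f H
  have hE1 := card_quotient_add_card_verts hpl hac hs hsH hH
  have hE2 := card_quotient_add_card_verts hpl hac hs (H := (bc f).union H) (Or.inr hsH)
    (isBackwardClosed_bc_union f hH)
  have hKf : ∀ {x}, dualSetoid ((bc f).union H).edgesᶜ f x → x = f := eq_of_dualSetoid_bc_union
  have hV : (((bc f).union H).verts \ H.verts).ncard + H.verts.ncard =
      ((bc f).union H).verts.ncard :=
    Set.ncard_sdiff_add_ncard_of_subset Set.subset_union_right
  set K : G.Sub := (bc f).union H with hKdef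
  have hE : (K.edges \ H.edges).ncard + H.edges.ncard = K.edges.ncard :=
    Set.ncard_sdiff_add_ncard_of_subset hHK
  have hVs : {w ∈ K.verts \ H.verts | ∃ e ∈ K.edges, e.tail = w}.ncard +
      {w ∈ K.verts \ H.verts | ¬ ∃ e ∈ K.edges, e.tail = w}.ncard = (K.verts \ H.verts).ncard :=
    Set.ncard_inter_add_ncard_sdiff_eq_ncard (K.verts \ H.verts) {w | ∃ e ∈ K.edges, e.tail = w}
  set M := {d ∈ newTargets H K | ¬ dartFace d = f} with hM
  have hMT : {d ∈ newTargets H K | dartFace d = f}.ncard + M.ncard = (newTargets H K).ncard :=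
    Set.ncard_inter_add_ncard_sdiff_eq_ncard (newTargets H K) {d | dartFace d = f}
  let mk : G.Face → Quotient (dualSetoid K.edgesᶜ) := Quotient.mk _
  -- The components that are not already components for `H`. The unchanged ones inject into the
  -- components for `H` and miss the one of `f`, which has been split.
  let A : Set (Quotient (dualSetoid K.edgesᶜ)) :=
    {q | ∃ x, mk x = q ∧ dualComponent K x ≠ dualComponent H x}
  let φ : Quotient (dualSetoid K.edgesᶜ) → Quotient (dualSetoid H.edgesᶜ) :=
    Quotient.map' id fun _ _ h => dualSetoid_mono (Set.compl_subset_compl.2 hHK) h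
  have hAc : ∀ x, mk x ∉ A → dualComponent K x = dualComponent H x := fun x hx => by
    by_contra h
    exact hx ⟨x, rfl, h⟩
  have hfA : mk f ∈ A := ⟨f, rfl, fun h => hgf (hKf (by
    rw [← mem_dualComponent, h, mem_dualComponent]
    exact hg))⟩
  have hcount : Aᶜ.ncard + 1 ≤ Nat.card (Quotient (dualSetoid H.edgesᶜ)) := by
    have hinj : Set.InjOn φ Aᶜ := by
      intro p hp q hq hpq
      induction p using Quotient.inductionOn with | _ x
      induction q using Quotient.inductionOn with | _ y
      have h1 : dualSetoid H.edgesᶜ x y := Quotient.exact hpq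
      rw [← mem_dualComponent, ← hAc x hp, mem_dualComponent] at h1
      exact Quotient.sound h1
    have hnot : Quotient.mk _ f ∉ φ '' Aᶜ := by
      rintro ⟨p, hp, hpf⟩
      induction p using Quotient.inductionOn with | _ x
      have h1 : dualSetoid H.edgesᶜ x f := Quotient.exact hpf
      rw [← mem_dualComponent, ← hAc x hp, mem_dualComponent] at h1
      have h2 : mk x = mk f := Quotient.sound h1
      exact hp (show mk x ∈ A by rw [h2]; exact hfA)
    rw [← hinj.ncard_image, ← Set.ncard_insert_of_notMem hnot, ← Set.ncard_univ]
    exact Set.ncard_le_ncard (Set.subset_univ _)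
  have hAA := Set.ncard_add_ncard_compl A
  have hB : (A \ {mk f}).ncard + 1 = A.ncard := Set.ncard_sdiff_singleton_add_one hfA
  have hsub : A \ {mk f} ⊆ (fun d => mk (dartFace d)) '' M := by
    rintro _ ⟨⟨x, rfl, hx⟩, hxf⟩
    obtain ⟨t, ht, hxt⟩ := exists_newTarget hac hHK hH hx
    have h1 : mk x = mk (dartFace t) := Quotient.sound hxt
    exact ⟨t, ⟨ht, fun h => hxf (by rw [h1, h]; rfl)⟩, h1.symm⟩
  have h1 := Set.ncard_le_ncard hsub
  have h2 : ((fun d => mk (dartFace d)) '' M).ncard ≤ M.ncard := Set.ncard_image_le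
  -- The count closes up: `M` has at most (new edges − new vertices) = (gain in components)
  -- elements, the gain is at most the size of `A \ {mk f}`, and this set is covered by the image of
  -- `M`. So the image is as large as `M`.
  have hinj : Set.InjOn (fun d => mk (dartFace d)) M :=
    Set.injOn_of_ncard_image_eq (by omega)
  refine hinj ⟨hd, hdf⟩ ⟨hd', fun h => hdf (hKf ?_)⟩ (Quotient.sound hdd')
  rw [← h]
  exact Setoid.symm' _ hdd'

/-! ### The choice of a face -/

/-- The target corners of `H` inside a set of faces of `G`. -/
def targetsIn (H : G.Sub) (R : Set G.Face) : Set G.toDigraph.Dart := targets H ∩ dartFace ⁻¹' R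

theorem ncard_targetsIn_bc_union_le (hpl : G.IsPlane) (hac : G.toDigraph.IsAcyclic) {s : V}
    (hs : ∀ v, G.Reaches s v) {H : G.Sub} (hsH : s ∈ H.verts) (hH : H.IsBackwardClosed)
    {f g : G.Face} (hgf : g ≠ f) (hg : dualSetoid H.edgesᶜ f g) :
    (targetsIn ((bc f).union H) (dualComponent ((bc f).union H) g)).ncard ≤
      (targetsIn H (dualComponent ((bc f).union H) g)).ncard + 1 := by
  have huniq := @newTargets_unique _ _ _ hpl hac _ hs _ hsH hH _ _ hgf hg
  have hKf : ∀ {x}, dualSetoid ((bc f).union H).edgesᶜ f x → x = f := eq_of_dualSetoid_bc_union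
  have hHK := edges_subset_bc_union f H
  set K : G.Sub := (bc f).union H with hKdef
  have hsub : targetsIn K (dualComponent K g) ⊆ targetsIn H (dualComponent K g) ∪
      {d ∈ newTargets H K | dartFace d ∈ dualComponent K g} := by
    rintro d ⟨h1, h2⟩
    by_cases hb : d.base ∈ H.verts
    · exact .inl ⟨mem_targets_of_base_mem hHK hH h1 hb, h2⟩
    · exact .inr ⟨⟨h1, hb⟩, h2⟩
  refine (Set.ncard_le_ncard hsub).trans ((Set.ncard_union_le _ _).trans ?_)
  refine Nat.add_le_add_left ((Set.ncard_le_one_iff (Set.toFinite _)).2 ?_) _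
  rintro d d' ⟨hd, hdg⟩ ⟨hd', hdg'⟩
  rw [mem_dualComponent] at hdg hdg'
  exact huniq hd hd' (fun h => hgf (hKf (h ▸ Setoid.symm' _ hdg)))
    (Setoid.trans' _ (Setoid.symm' _ hdg) hdg')

/-- A component that arises from adding the backward closure of a face contains a face `f₁`
whose backward closure already bounds it. -/
theorem exists_face_closed (hpl : G.IsPlane) (hac : G.toDigraph.IsAcyclic) {s : V}
    (hs : ∀ v, G.Reaches s v) {H : G.Sub} (hsH : s ∈ H.verts) (hH : H.IsBackwardClosed)
    {f g : G.Face} (hgf : g ≠ f) (hg : dualSetoid H.edgesᶜ f g) :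
    ∃ f₁ ∈ dualComponent ((bc f).union H) g, ∀ d : G.toDigraph.Dart,
      d.1 ∉ ((bc f₁).union H).edges → dartFace d ∈ dualComponent ((bc f).union H) g →
        dartFace d.rev ∈ dualComponent ((bc f).union H) g := by
  have huniq := @newTargets_unique _ _ _ hpl hac _ hs _ hsH hH _ _ hgf hg
  have hKf : ∀ {x}, dualSetoid ((bc f).union H).edgesᶜ f x → x = f := eq_of_dualSetoid_bc_union
  have hHK := edges_subset_bc_union f H
  set K : G.Sub := (bc f).union H with hKdef
  have hne : dualComponent K g ≠ dualComponent H g := fun h => hgf (hKf (by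
    refine Setoid.symm' _ ?_
    rw [← mem_dualComponent, h, mem_dualComponent]
    exact Setoid.symm' _ hg))
  obtain ⟨t, ht, hgt⟩ := exists_newTarget hac hHK hH hne
  refine ⟨dartFace t, mem_dualComponent.2 hgt, fun d hd hdg => ?_⟩
  rw [mem_dualComponent] at hdg ⊢
  by_cases hdK : d.1 ∈ K.edges
  -- The boundary edge leads to a new target corner of the same component, which by uniqueness is
  -- `t`. So its head reaches a vertex of `f₁`.
  · obtain ⟨t', ht', h1, h2⟩ := exists_newTarget_of_dart hac hH hdK fun h => hd (.inr h)
    have htt : t = t' := huniq ht ht' (fun h => hgf (hKf (h ▸ Setoid.symm' _ hgt)))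
      (Setoid.trans' _ (Setoid.symm' _ hgt) (Setoid.trans' _ hdg h1))
    exact absurd (.inl ⟨t.base, base_mem_verts t, htt ▸ h2⟩) hd
  · exact Setoid.trans' _ hdg (dualSetoid_dart hdK)

/-- The face that is chosen in a component of the dual graph: every new component has at most two
target corners, and is at most half as large or has fewer target corners. -/
theorem exists_face_select (hpl : G.IsPlane) (hac : G.toDigraph.IsAcyclic) {s : V}
    (hs : ∀ v, G.Reaches s v) {H : G.Sub} (hsH : s ∈ H.verts) (hH : H.IsBackwardClosed)
    (g₀ : G.Face) (hF : (targetsIn H (dualComponent H g₀)).ncard ≤ 2) :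
    ∃ f ∈ dualComponent H g₀, ∀ g ∈ dualComponent H g₀, g ≠ f →
      (targetsIn ((bc f).union H) (dualComponent ((bc f).union H) g)).ncard ≤ 2 ∧
      (2 * (dualComponent ((bc f).union H) g).ncard ≤ (dualComponent H g₀).ncard ∨
        (targetsIn H (dualComponent H g₀)).ncard = 2 ∧
        (targetsIn ((bc f).union H) (dualComponent ((bc f).union H) g)).ncard ≤ 1) := by
  set F := dualComponent H g₀ with hFdef
  -- The negation, with one more target corner allowed for, is what is claimed of each part. Two
  -- disjoint bad subsets would exceed either the size of `F` or its at most two target corners.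
  let bad : Set G.Face → Prop := fun R => 2 ≤ (targetsIn H R).ncard ∨
    (F.ncard < 2 * R.ncard ∧ ((targetsIn H F).ncard ≤ 1 ∨ 1 ≤ (targetsIn H R).ncard))
  have hconn : ∀ {f g}, f ∈ F → g ∈ F → dualSetoid H.edgesᶜ f g := fun hf hg =>
    Setoid.trans' _ (Setoid.symm' _ (mem_dualComponent.1 hf)) (mem_dualComponent.1 hg)
  have hsubF : ∀ {f g}, g ∈ F → dualComponent ((bc f).union H) g ⊆ F := fun hg x hx =>
    mem_dualComponent.2 (Setoid.trans' _ (mem_dualComponent.1 hg)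
      (mem_dualComponent.1 (dualComponent_anti (edges_subset_bc_union _ H) _ hx)))
  have hdisj : ∀ {R R' : Set G.Face}, R ⊆ F → R' ⊆ F → Disjoint R R' →
      R.ncard + R'.ncard ≤ F.ncard ∧
        (targetsIn H R).ncard + (targetsIn H R').ncard ≤ (targetsIn H F).ncard := by
    intro R R' h1 h2 h3
    constructor
    · rw [← Set.ncard_union_eq h3]
      exact Set.ncard_le_ncard (Set.union_subset h1 h2)
    · rw [← Set.ncard_union_eq]
      · refine Set.ncard_le_ncard (Set.union_subset ?_ ?_)
        · exact Set.inter_subset_inter_right _ (Set.preimage_mono h1)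
        · exact Set.inter_subset_inter_right _ (Set.preimage_mono h2)
      · exact ((h3.preimage dartFace).inter_left' _).inter_right' _
  obtain ⟨f, hf, hgood⟩ : ∃ f ∈ F, ∀ g ∈ F, g ≠ f → ¬ bad (dualComponent ((bc f).union H) g) := by
    by_contra! hno
    have key : ∀ n, ∀ f ∈ F, ∀ g ∈ F, g ≠ f → bad (dualComponent ((bc f).union H) g) →
        (dualComponent ((bc f).union H) g).ncard = n → False := by
      intro n
      induction n using Nat.strong_induction_on with
      | _ n ih =>
        intro f hf g hg hgf hbad hn
        obtain ⟨f₁, hf₁, hclosed⟩ := exists_face_closed hpl hac hs hsH hH hgf (hconn hf hg)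
        have hRF := hsubF (f := f) hg
        set R := dualComponent ((bc f).union H) g with hR
        obtain ⟨g₁, hg₁, hne, hbad₁⟩ := hno f₁ (hRF hf₁)
        have hR₁F := hsubF (f := f₁) hg₁
        -- Since `R` is closed under crossing edges outside `bc f₁ ∪ H`, the bad part left by `f₁`
        -- lies inside `R`, without `f₁` and hence smaller, or is disjoint from `R`.
        by_cases hg₁R : g₁ ∈ R
        · refine ih _ ?_ f₁ (hRF hf₁) g₁ hg₁ hne hbad₁ rfl
          rw [← hn]
          refine Set.ncard_lt_ncard ((Set.ssubset_iff_of_subset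
            (dualComponent_subset hg₁R hclosed)).2 ⟨f₁, hf₁, fun h => ?_⟩)
          exact hne (eq_of_dualSetoid_bc_union (Setoid.symm' _ (mem_dualComponent.1 h)))
        · have hsub : dualComponent ((bc f₁).union H) g₁ ⊆ Rᶜ :=
            dualComponent_subset hg₁R fun d hd hdR h => hdR (by
              have := hclosed d.rev hd h
              rwa [rev_rev] at this)
          obtain ⟨h1, h2⟩ := hdisj hRF hR₁F (Set.disjoint_left.2 fun x hx hx' => hsub hx' hx)
          simp only [bad] at hbad hbad₁
          omega
    obtain ⟨g, hg, hne, hbad⟩ := hno g₀ (self_mem_dualComponent H g₀)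
    exact key _ g₀ (self_mem_dualComponent H g₀) g hg hne hbad rfl
  refine ⟨f, hf, fun g hg hne => ?_⟩
  have h1 := hgood g hg hne
  have h2 := ncard_targetsIn_bc_union_le hpl hac hs hsH hH hne (hconn hf hg)
  simp only [bad] at h1
  omega

end EmbeddedDigraph

/-! ### Rooted trees from parent functions -/

section Tree

variable {α : Type u} {p : α → α} {r : α} {δ : α → ℕ}

/-- The rank `δ` rules out cycles of parents; this gives antisymmetry of the ancestor order. -/
theorem iterate_eq_or_lt (hδ : ∀ x, x ≠ r → δ (p x) < δ x) (hr : p r = r) (k : ℕ) (x : α) :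
    p^[k] x = x ∨ δ (p^[k] x) < δ x := by
  induction k with
  | zero => exact .inl rfl
  | succ k ih =>
    rw [Function.iterate_succ_apply']
    by_cases h : p^[k] x = r
    · rwa [h, hr, ← h]
    · have := hδ _ h
      rcases ih with ih | ih
      · right
        rwa [ih] at this ⊢
      · exact .inr (this.trans ih)

theorem exists_iterate_eq (hδ : ∀ x, x ≠ r → δ (p x) < δ x) (x : α) : ∃ k, p^[k] x = r := by
  induction h : δ x using Nat.strong_induction_on generalizing x with
  | _ n ih =>
    by_cases hx : x = r
    · exact ⟨0, hx⟩
    · obtain ⟨k, hk⟩ := ih _ (h ▸ hδ x hx) (p x) rfl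
      exact ⟨k + 1, hk⟩

open Classical in
/-- The rooted tree with a given root and given parents. -/
noncomputable def RootedTree.ofParent (p : α → α) (r : α) (δ : α → ℕ)
    (hδ : ∀ x, x ≠ r → δ (p x) < δ x) (hr : p r = r) : RootedTree.{u} :=
  letI : PartialOrder α :=
    { le := fun x y => ∃ k, p^[k] y = x
      le_refl := fun x => ⟨0, rfl⟩
      le_trans := by
        rintro _ _ z ⟨k, rfl⟩ ⟨m, rfl⟩
        exact ⟨k + m, Function.iterate_add_apply p k m z⟩
      le_antisymm := by
        rintro x y ⟨k, hk⟩ ⟨m, hm⟩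
        rcases iterate_eq_or_lt hδ hr k y with h | h
        · exact hk.symm.trans h
        · rcases iterate_eq_or_lt hδ hr m x with h' | h'
          · exact h'.symm.trans hm
          · rw [hk] at h
            rw [hm] at h'
            omega }
  have hle : ∀ x, p x ≤ x := fun x => show ∃ k, p^[k] x = p x from ⟨1, rfl⟩
  letI : PredOrder α :=
    { pred := p
      pred_le := hle
      min_of_le_pred := by
        intro x hx
        have h1 : p x = x := le_antisymm (hle x) hx
        have h2 : x = r := by
          by_contra h
          have := hδ x h
          rw [h1] at this
          omega
        rintro _ ⟨k, rfl⟩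
        exact ⟨0, by rw [h2, Function.iterate_fixed hr]; rfl⟩
      le_pred_of_lt := by
        rintro _ y ⟨⟨k, rfl⟩, h⟩
        rcases k with _ | k
        · exact absurd ⟨0, rfl⟩ h
        · exact ⟨k, rfl⟩ }
  { α := α
    semilatticeInf :=
      -- The first ancestor of `x`, counted from `x`, that is also an ancestor of `y`.
      { inf := fun x y => p^[Nat.find (p := fun k => ∃ m, p^[m] y = p^[k] x) (by
          obtain ⟨k, hk⟩ := exists_iterate_eq hδ x
          obtain ⟨m, hm⟩ := exists_iterate_eq hδ y
          exact ⟨k, m, hm.trans hk.symm⟩)] x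
        inf_le_left := fun x y => ⟨_, rfl⟩
        inf_le_right := fun x y => Nat.find_spec (p := fun k => ∃ m, p^[m] y = p^[k] x) _
        le_inf := by
          rintro _ x y ⟨k, rfl⟩ h
          have hk := Nat.find_min' (p := fun k => ∃ m, p^[m] y = p^[k] x) ⟨k, h⟩ h
          exact ⟨k - _, by rw [← Function.iterate_add_apply, Nat.sub_add_cancel hk]⟩ }
    orderBot :=
      { bot := r
        bot_le := exists_iterate_eq hδ }
    predOrder := inferInstance
    isPredArchimedean := ⟨fun h => h⟩ }

end Tree

namespace EmbeddedDigraph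

open Digraph

variable {V : Type u} [Finite V] {G : EmbeddedDigraph V}

/-! ### The decomposition -/

/-- The property of the face that is chosen in the component `F`. -/
def IsSplitting (H : G.Sub) (F : Set G.Face) (f : G.Face) : Prop :=
  f ∈ F ∧ ∀ g ∈ F, g ≠ f →
    (targetsIn ((bc f).union H) (dualComponent ((bc f).union H) g)).ncard ≤ 2 ∧
    (2 * (dualComponent ((bc f).union H) g).ncard ≤ F.ncard ∨
      (targetsIn H F).ncard = 2 ∧
      (targetsIn ((bc f).union H) (dualComponent ((bc f).union H) g)).ncard ≤ 1)

/-- The face chosen in the component of `g`. -/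
noncomputable def splittingFace (H : G.Sub) (g : G.Face) : G.Face :=
  @Classical.epsilon _ ⟨g⟩ (IsSplitting H (dualComponent H g))

/-- The choice is a function of the component alone. So faces that are not yet separated share their
whole history of splittings, which is what makes these histories a tree. -/
theorem splittingFace_congr {H : G.Sub} {g h : G.Face} (hgh : dualSetoid H.edgesᶜ g h) :
    splittingFace H h = splittingFace H g := by
  unfold splittingFace
  rw [dualComponent_eq_iff.2 hgh]

/-- The subgraphs obtained by splitting the component of `g` repeatedly, starting from `s`. -/
noncomputable def splitSub (s : V) (g : G.Face) : ℕ → G.Sub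
  | 0 => Subdigraph.backwardClosure G.toDigraph {s}
  | i + 1 => (bc (splittingFace (splitSub s g i) g)).union (splitSub s g i)

/-- The faces chosen when the component of `g` is split repeatedly. -/
noncomputable def splitFace (s : V) (g : G.Face) (i : ℕ) : G.Face :=
  splittingFace (splitSub s g i) g

/-! ### Histories of splittings -/

section Split

variable {s : V} {g h : G.Face} {i j : ℕ}

theorem splitSub_mono (hij : i ≤ j) : (splitSub s g i).edges ⊆ (splitSub s g j).edges := by
  induction hij with
  | refl => exact subset_rfl
  | step _ ih => exact ih.trans (edges_subset_bc_union _ _)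

theorem splitSub_conn_mono (hij : i ≤ j) (hgh : dualSetoid (splitSub s g j).edgesᶜ g h) :
    dualSetoid (splitSub s g i).edgesᶜ g h :=
  dualSetoid_mono (Set.compl_subset_compl.2 (splitSub_mono hij)) hgh

theorem splitSub_congr (hgh : dualSetoid (splitSub s g i).edgesᶜ g h) :
    splitSub s h i = splitSub s g i := by
  induction i with
  | zero => rfl
  | succ i ih =>
    have h1 := splitSub_conn_mono (Nat.le_succ i) hgh
    rw [splitSub, splitSub, ih h1, splittingFace_congr h1]

theorem splitFace_congr (hgh : dualSetoid (splitSub s g i).edgesᶜ g h) :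
    splitFace s h i = splitFace s g i := by
  rw [splitFace, splitFace, splitSub_congr hgh, splittingFace_congr hgh]

theorem splitSub_succ_congr (hgh : dualSetoid (splitSub s g i).edgesᶜ g h) :
    splitSub s h (i + 1) = splitSub s g (i + 1) := by
  change (bc (splitFace s h i)).union _ = (bc (splitFace s g i)).union _
  rw [splitSub_congr hgh, splitFace_congr hgh]

theorem source_mem_splitSub : s ∈ (splitSub s g i).verts := by
  induction i with
  | zero => exact ⟨s, rfl, .refl⟩
  | succ i ih => exact .inr ih

theorem isBackwardClosed_splitSub : (splitSub s g i).IsBackwardClosed := by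
  induction i with
  | zero => exact (Subdigraph.isLeast_backwardClosure _ _).1.1
  | succ i ih => exact isBackwardClosed_bc_union _ ih

/-- An edge whose head reaches `s` would close a directed cycle. So the splitting starts from the
single vertex `s`, with all faces in one component. -/
theorem edges_splitSub_zero (hac : G.toDigraph.IsAcyclic) (hs : ∀ v, G.Reaches s v) :
    (splitSub s g 0).edges = ∅ := by
  rw [Set.eq_empty_iff_forall_notMem]
  rintro e ⟨v, rfl, hv⟩
  exact hac e.tail (Relation.TransGen.head' e.2 (hv.trans (hs _)))

theorem splitSub_zero_conn (hac : G.toDigraph.IsAcyclic) (hs : ∀ v, G.Reaches s v) :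
    dualSetoid (splitSub s g 0).edgesᶜ g h := by
  rw [edges_splitSub_zero hac hs, Set.compl_empty]
  exact dualSetoid_univ hs g h

theorem isSplitting_splitFace (hpl : G.IsPlane) (hac : G.toDigraph.IsAcyclic)
    (hs : ∀ v, G.Reaches s v) (g : G.Face) (i : ℕ) :
    IsSplitting (splitSub s g i) (dualComponent (splitSub s g i) g) (splitFace s g i) := by
  have key : ∀ i, (targetsIn (splitSub s g i) (dualComponent (splitSub s g i) g)).ncard ≤ 2 →
      IsSplitting (splitSub s g i) (dualComponent (splitSub s g i) g) (splitFace s g i) :=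
    fun i h => Classical.epsilon_spec_aux _ _
      (exists_face_select hpl hac hs source_mem_splitSub isBackwardClosed_splitSub g h)
  induction i with
  | zero =>
    apply key
    have : targetsIn (splitSub s g 0) (dualComponent (splitSub s g 0) g) = ∅ := by
      rw [Set.eq_empty_iff_forall_notMem]
      rintro d ⟨⟨h, -⟩, -⟩
      rwa [edges_splitSub_zero hac hs] at h
    rw [this]
    simp
  | succ i ih =>
    -- Once `g` is chosen, its component is `{g}` and the condition is vacuous; no bound on target
    -- corners is available there, nor needed.
    by_cases hg : g = splitFace s g i
    · refine Classical.epsilon_spec_aux _ _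
        ⟨g, self_mem_dualComponent _ _, fun g' hg' hne => absurd ?_ hne⟩
      have h1 : dualComponent (splitSub s g (i + 1)) g = {g} := by
        change dualComponent ((bc (splitFace s g i)).union _) g = {g}
        rw [← hg]
        exact dualComponent_bc_union g _
      rwa [h1] at hg'
    · exact key _ (ih.2 g (self_mem_dualComponent _ _) hg).1

theorem eq_splitFace_of_conn (h' : dualSetoid (splitSub s g (i + 1)).edgesᶜ g (splitFace s g i)) :
    g = splitFace s g i := eq_of_dualSetoid_bc_union (Setoid.symm' _ h')

end Split

/-- A connected acyclic plane digraph, with its source. -/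
structure SingleSourcePlane (G : EmbeddedDigraph V) (s : V) : Prop where
  plane : G.IsPlane
  acyclic : G.toDigraph.IsAcyclic
  reaches : ∀ v, G.Reaches s v

/-! ### Ancestors, height and the assembled decomposition -/

namespace SingleSourcePlane

variable {s : V} {g h : G.Face} {i j : ℕ}

theorem isSplitting (hG : SingleSourcePlane G s) (g : G.Face) (i : ℕ) :
    IsSplitting (splitSub s g i) (dualComponent (splitSub s g i) g) (splitFace s g i) :=
  isSplitting_splitFace hG.plane hG.acyclic hG.reaches g i

theorem conn_splitFace (hG : SingleSourcePlane G s) (g : G.Face) (hij : i ≤ j) :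
    dualSetoid (splitSub s g i).edgesᶜ g (splitFace s g j) :=
  splitSub_conn_mono hij (mem_dualComponent.1 (hG.isSplitting g j).1)

theorem splitFace_splitFace (hG : SingleSourcePlane G s) (g : G.Face) (hij : i ≤ j) :
    splitFace s (splitFace s g j) i = splitFace s g i :=
  splitFace_congr (hG.conn_splitFace g hij)

/-- A chosen face is alone in its component from then on, so the sequence stays constant. -/
theorem splitFace_succ (hG : SingleSourcePlane G s) (hg : splitFace s g i = g) :
    splitFace s g (i + 1) = g := by
  have h1 := hG.conn_splitFace g (le_refl (i + 1))
  change dualSetoid ((bc (splitFace s g i)).union _).edgesᶜ g _ at h1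
  rw [hg] at h1
  exact eq_of_dualSetoid_bc_union h1

theorem splitFace_of_le (hG : SingleSourcePlane G s) (hg : splitFace s g i = g) (hij : i ≤ j) :
    splitFace s g j = g := by
  induction hij with
  | refl => exact hg
  | step _ ih => exact hG.splitFace_succ ih

theorem eq_of_splitFace_eq (hG : SingleSourcePlane G s) (hij : i < j)
    (he : splitFace s g i = splitFace s g j) : splitFace s g i = g :=
  (eq_splitFace_of_conn (he ▸ hG.conn_splitFace g hij)).symm

/-- Until `g` is chosen, no face is chosen twice, and there are finitely many faces. -/
theorem exists_splitFace_eq (hG : SingleSourcePlane G s) (g : G.Face) :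
    ∃ i, splitFace s g i = g := by
  by_contra! hno
  have : Function.Injective (splitFace s g) := by
    intro i j hij
    rcases lt_trichotomy i j with h | h | h
    · exact absurd (hG.eq_of_splitFace_eq h hij) (hno i)
    · exact h
    · exact absurd (hG.eq_of_splitFace_eq h hij.symm) (hno j)
  exact not_injective_infinite_finite _ this

open Classical in
/-- The number of the step at which `g` itself is chosen. -/
noncomputable def height (hG : SingleSourcePlane G s) (g : G.Face) : ℕ :=
  Nat.find (hG.exists_splitFace_eq g)

theorem splitFace_height (hG : SingleSourcePlane G s) (g : G.Face) :
    splitFace s g (hG.height g) = g := by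
  classical exact Nat.find_spec (hG.exists_splitFace_eq g)

theorem height_le (hG : SingleSourcePlane G s) (hg : splitFace s g i = g) : hG.height g ≤ i := by
  classical exact Nat.find_min' (hG.exists_splitFace_eq g) hg

/-- The parent of a face. -/
noncomputable def parent (hG : SingleSourcePlane G s) (g : G.Face) : G.Face :=
  splitFace s g (hG.height g - 1)

/-- The histories of `g` and its parent agree up to the step at which the parent is chosen. An
earlier choice of the parent would repeat in the history of `g` and would have to be `g` itself. -/
theorem height_parent (hG : SingleSourcePlane G s) (hg : hG.height g ≠ 0) :
    hG.height (hG.parent g) + 1 = hG.height g := by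
  have h1 : hG.height (hG.parent g) ≤ hG.height g - 1 :=
    hG.height_le (hG.splitFace_splitFace g le_rfl)
  have h2 := hG.splitFace_height (hG.parent g)
  rw [show splitFace s (hG.parent g) _ = splitFace s g _ from hG.splitFace_splitFace g h1] at h2
  rcases h1.lt_or_eq with h3 | h3
  · have := hG.height_le (hG.eq_of_splitFace_eq h3 h2)
    rw [parent] at h3
    omega
  · omega

theorem splitFace_zero (hG : SingleSourcePlane G s) (g h : G.Face) :
    splitFace s g 0 = splitFace s h 0 :=
  splitFace_congr (splitSub_zero_conn hG.acyclic hG.reaches)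

theorem height_ne_zero (hG : SingleSourcePlane G s) (hg : g ≠ splitFace s h 0) :
    hG.height g ≠ 0 := fun h0 => hg (by
  rw [← hG.splitFace_zero g h, ← h0]
  exact (hG.splitFace_height g).symm)

/-- Truncated subtraction at height 0 makes the root its own parent, as `RootedTree.ofParent`
requires. -/
theorem parent_root (hG : SingleSourcePlane G s) (h : G.Face) :
    hG.parent (splitFace s h 0) = splitFace s h 0 := by
  have : hG.height (splitFace s h 0) = 0 :=
    Nat.le_zero.1 (hG.height_le (hG.splitFace_splitFace h le_rfl))
  rw [parent, this]
  exact hG.splitFace_splitFace h le_rfl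

/-- The tree of the decomposition. -/
noncomputable def tree (hG : SingleSourcePlane G s) (h : G.Face) : RootedTree.{u} :=
  RootedTree.ofParent hG.parent (splitFace s h 0) hG.height
    (fun x hx => by have := hG.height_parent (hG.height_ne_zero hx); omega) (hG.parent_root h)

theorem exists_iterate_parent_iff (hG : SingleSourcePlane G s) {x y : G.Face} :
    (∃ k, hG.parent^[k] y = x) ↔ ∃ i, splitFace s y i = x := by
  constructor
  · rintro ⟨k, rfl⟩
    induction k with
    | zero => exact ⟨hG.height y, hG.splitFace_height y⟩
    | succ k ih =>
      obtain ⟨i, hi⟩ := ih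
      refine ⟨hG.height (hG.parent^[k] y) - 1, ?_⟩
      rw [Function.iterate_succ_apply', ← hi]
      have h1 : hG.height (splitFace s y i) ≤ i :=
        hG.height_le (hG.splitFace_splitFace y le_rfl)
      exact (hG.splitFace_splitFace y (by omega)).symm
  · rintro ⟨i, rfl⟩
    induction hn : hG.height y using Nat.strong_induction_on generalizing y with
    | _ n ih =>
      by_cases hi : hG.height y ≤ i
      · exact ⟨0, (hG.splitFace_of_le (hG.splitFace_height y) hi).symm⟩
      · have h1 := hG.height_parent (g := y) (by omega)
        obtain ⟨k, hk⟩ := ih _ (by omega) (y := hG.parent y) rfl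
        exact ⟨k + 1, hk.trans (hG.splitFace_splitFace y (by omega))⟩

theorem tree_le_iff (hG : SingleSourcePlane G s) (h : G.Face) {x y : hG.tree h} :
    x ≤ y ↔ ∃ i, splitFace s (G := G) y i = x := hG.exists_iterate_parent_iff

/-- The potential is the squared size, doubled when there are two target corners. Halving the size
divides the square by 4 and at worst doubles the weight; otherwise the weight drops from 2 to 1. The
potential at least halves either way. -/
theorem two_pow_mul_le (hG : SingleSourcePlane G s) (g : G.Face) (hi : i ≤ hG.height g) :
    2 ^ i * (dualComponent (splitSub s g i) g).ncard ^ 2 *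
      (if (targetsIn (splitSub s g i) (dualComponent (splitSub s g i) g)).ncard = 2
        then 2 else 1) ≤ Nat.card G.Face ^ 2 := by
  induction i with
  | zero =>
    have h1 : targetsIn (splitSub s g 0) (dualComponent (splitSub s g 0) g) = ∅ := by
      rw [Set.eq_empty_iff_forall_notMem]
      rintro d ⟨⟨h, -⟩, -⟩
      rwa [edges_splitSub_zero hG.acyclic hG.reaches] at h
    rw [h1]
    simp only [pow_zero, one_mul, Set.ncard_empty, OfNat.zero_ne_ofNat, if_false, mul_one]
    rw [← Set.ncard_univ]
    exact Nat.pow_le_pow_left (Set.ncard_le_ncard (Set.subset_univ _)) 2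
  | succ i ih =>
    refine le_trans ?_ (ih (by omega))
    have hne : g ≠ splitFace s g i := fun h => by
      have := hG.height_le h.symm
      omega
    have h1 := (hG.isSplitting g i).2 g (self_mem_dualComponent _ _) hne
    have h2 : (dualComponent (splitSub s g (i + 1)) g).ncard ≤
        (dualComponent (splitSub s g i) g).ncard :=
      Set.ncard_le_ncard (dualComponent_anti (splitSub_mono (Nat.le_succ i)) g)
    change (targetsIn (splitSub s g (i + 1)) (dualComponent (splitSub s g (i + 1)) g)).ncard ≤ 2 ∧
      (2 * (dualComponent (splitSub s g (i + 1)) g).ncard ≤ _ ∨ _ ∧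
      (targetsIn (splitSub s g (i + 1)) (dualComponent (splitSub s g (i + 1)) g)).ncard ≤ 1) at h1
    revert h2 h1
    generalize (targetsIn (splitSub s g (i + 1)) (dualComponent (splitSub s g (i + 1)) g)).ncard = t'
    generalize (dualComponent (splitSub s g (i + 1)) g).ncard = N'
    generalize (targetsIn (splitSub s g i) (dualComponent (splitSub s g i) g)).ncard = t
    generalize (dualComponent (splitSub s g i) g).ncard = N
    rintro h2 ⟨ht', h3 | ⟨ht, h3⟩⟩
    · calc 2 ^ (i + 1) * N' ^ 2 * (if t' = 2 then 2 else 1) ≤ 2 ^ (i + 1) * N' ^ 2 * 2 := by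
            gcongr
            split_ifs <;> omega
        _ = 2 ^ i * (2 * N') ^ 2 * 1 := by ring
        _ ≤ _ := by
            gcongr
            split_ifs <;> omega
    · rw [if_neg (by omega), if_pos ht]
      calc 2 ^ (i + 1) * N' ^ 2 * 1 = 2 ^ i * N' ^ 2 * 2 := by ring
        _ ≤ _ := by gcongr

theorem two_pow_height_le (hG : SingleSourcePlane G s) (g : G.Face) :
    2 ^ hG.height g ≤ Nat.card G.Face ^ 2 := by
  refine le_trans ?_ (hG.two_pow_mul_le g le_rfl)
  have h1 : 0 < (dualComponent (splitSub s g (hG.height g)) g).ncard :=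
    (Set.ncard_pos (Set.toFinite _)).2 ⟨g, self_mem_dualComponent _ _⟩
  rw [mul_assoc]
  refine Nat.le_mul_of_pos_right _ (Nat.mul_pos (by positivity) ?_)
  split_ifs <;> omega

/-- There are no loops, so edges and diagonal pairs together embed in `V × V`; Euler's formula does
the rest. -/
theorem card_face_le (hG : SingleSourcePlane G s) : Nat.card G.Face ≤ Nat.card V ^ 2 := by
  have h1 := euler hG.plane hG.reaches
  have h2 : Nat.card (G.toDigraph.Edge ⊕ V) ≤ Nat.card (V × V) := by
    refine Nat.card_le_card_of_injective (Sum.elim Subtype.val fun v => (v, v)) ?_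
    refine Function.Injective.sumElim Subtype.val_injective (fun a b h => (Prod.ext_iff.1 h).1) ?_
    rintro ⟨⟨a, b⟩, hab⟩ c h
    obtain ⟨h3, h4⟩ := Prod.ext_iff.1 h
    change a = c at h3
    change b = c at h4
    subst h3 h4
    exact hG.acyclic b (.single hab)
  rw [Nat.card_sum, Nat.card_prod] at h2
  have : Nonempty V := ⟨s⟩
  have h3 : 0 < Nat.card V := Nat.card_pos
  rw [sq]
  omega

/-- The component of `x` from which `x` is chosen is bounded by a face of the subgraph at its
parent, with alternation number 2 or 4. -/
theorem exists_frame (hG : SingleSourcePlane G s) {x : G.Face} (hx : hG.height x ≠ 0) {K : G.Sub}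
    (hK : K = splitSub s x (hG.height x)) : ∃ F : Sub.Face K, F.subfaces = dualComponent K x ∧
      (F.HasAlternationNumber 2 ∨ F.HasAlternationNumber 4) := by
  obtain ⟨i, hi⟩ := Nat.exists_eq_succ_of_ne_zero hx
  have hne : x ≠ splitFace s x i := fun h => by
    have := hG.height_le h.symm
    omega
  rw [hi] at hK
  have ht : (targetsIn K (dualComponent K x)).ncard ≤ 2 := by
    rw [hK]
    exact ((hG.isSplitting x i).2 x (self_mem_dualComponent _ _) hne).1
  -- A component without boundary edges would contain all faces, in particular the previously chosen
  -- one, which is isolated.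
  obtain ⟨d, hd, hdx⟩ : ∃ d : G.toDigraph.Dart, d.1 ∈ K.edges ∧ dartFace d ∈ dualComponent K x := by
    by_contra! hno
    have h1 : dualComponent (splitSub s x 0) x ⊆ dualComponent K x := by
      refine dualComponent_subset (self_mem_dualComponent _ _) fun d _ hdx => ?_
      have hdK : d.1 ∈ K.edgesᶜ := fun h => hno d h hdx
      rw [mem_dualComponent] at hdx ⊢
      exact Setoid.trans' _ hdx (dualSetoid_dart hdK)
    have h2 := h1 (mem_dualComponent.2
      (splitSub_zero_conn hG.acyclic hG.reaches (h := splitFace s x i)))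
    rw [hK] at h2
    exact hne (eq_splitFace_of_conn (mem_dualComponent.1 h2))
  have hcomp : dualComponent K (dartFace d) = dualComponent K x :=
    dualComponent_eq_iff.2 (Setoid.symm' _ (mem_dualComponent.1 hdx))
  refine ⟨Sub.faceOf (Sum.inl ⟨d, hd⟩), (subfaces_faceOf _).trans hcomp, ?_⟩
  refine hasAlternationNumber_of_ncard_le hG.acyclic _ ?_
  change (targetsIn K (dualComponent K (dartFace d))).ncard ≤ 2
  rw [hcomp]
  exact ht

/-- The subgraph `S` of the parent is the one whose component `x` is chosen from. -/
theorem splitSub_parent (hG : SingleSourcePlane G s) {x : G.Face} (hx : hG.height x ≠ 0) :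
    splitSub s (hG.parent x) (hG.height (hG.parent x) + 1) = splitSub s x (hG.height x) := by
  have h1 := hG.height_parent hx
  rw [← h1]
  refine splitSub_succ_congr ?_
  have h2 := hG.conn_splitFace x (le_refl (hG.height x - 1))
  rwa [show hG.height (hG.parent x) = hG.height x - 1 by omega]

theorem splitSub_height_succ (hG : SingleSourcePlane G s) (x : G.Face) :
    splitSub s x (hG.height x + 1) = (bc x).union (splitSub s x (hG.height x)) := by
  change (bc (splitFace s x (hG.height x))).union _ = _
  rw [hG.splitFace_height]

/-- The source reaches a vertex of the face, so the initial subgraph is absorbed by its backward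
closure. -/
theorem splitSub_root (hG : SingleSourcePlane G s) (h : G.Face) :
    splitSub s (splitFace s h 0) (hG.height (splitFace s h 0) + 1) = bc (splitFace s h 0) := by
  have h0 : hG.height (splitFace s h 0) = 0 :=
    Nat.le_zero.1 (hG.height_le (hG.splitFace_splitFace h le_rfl))
  rw [hG.splitSub_height_succ, h0]
  obtain ⟨c, hc⟩ := Quot.exists_rep (splitFace s h 0)
  have hv : Sub.cornerVertex c ∈ (splitFace s h 0).verts := ⟨c, hc, rfl⟩
  have h1 : s ∈ (bc (splitFace s h 0)).verts := ⟨_, hv, hG.reaches _⟩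
  have h2 := (Subdigraph.isLeast_backwardClosure G.toDigraph {s}).2
    ⟨(Subdigraph.isLeast_backwardClosure G.toDigraph (splitFace s h 0).verts).1.1,
      Set.singleton_subset_iff.2 h1⟩
  exact Subdigraph.ext (Set.union_eq_left.2 h2.1) (Set.union_eq_left.2 h2.2)

/-- The descendants of `x` are the faces not yet separated from `x` when `x` is chosen. -/
theorem exists_splitFace_eq_iff (hG : SingleSourcePlane G s) {x y : G.Face} :
    (∃ i, splitFace s y i = x) ↔ y ∈ dualComponent (splitSub s x (hG.height x)) x := by
  rw [mem_dualComponent]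
  constructor
  · rintro ⟨i, rfl⟩
    have h1 : hG.height (splitFace s y i) ≤ i := hG.height_le (hG.splitFace_splitFace y le_rfl)
    have h2 := hG.conn_splitFace y (le_refl i)
    rw [← splitSub_congr h2] at h2
    exact splitSub_conn_mono h1 (Setoid.symm' _ h2)
  · intro hxy
    exact ⟨hG.height x, (splitFace_congr hxy).trans (hG.splitFace_height x)⟩

theorem le_iff_mem_dualComponent (hG : SingleSourcePlane G s) (h : G.Face) {x y : hG.tree h} :
    x ≤ y ↔ (y : G.Face) ∈ dualComponent (splitSub s (G := G) x (hG.height x)) x :=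
  (hG.tree_le_iff h).trans hG.exists_splitFace_eq_iff

open Classical in
/-- The decomposition. -/
noncomputable def decomposition (hG : SingleSourcePlane G s) (h : G.Face) : G.STDecomposition :=
  let S : G.Face → G.Sub := fun x => splitSub s x (hG.height x + 1)
  let C : G.Face → G.Sub := fun x =>
    if x = splitFace s h 0 then bc x else (bc x).diff (S (hG.parent x))
  let frame : ∀ x : G.Face, x ≠ splitFace s h 0 → Sub.Face (S (hG.parent x)) := fun x hx =>
    (hG.exists_frame (hG.height_ne_zero hx) (hG.splitSub_parent (hG.height_ne_zero hx))).choose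
  { tree := hG.tree h
    face := fun x => x
    S := S
    C := C
    dualVerts := fun x => {f : G.Face | x ≤ (f : hG.tree h)}
    frame := frame
    downEdges := fun x hx => {e | e.tail ∈ (frame x hx).verts ∧
      ∃ z : hG.tree h, x ≤ z ∧ e.head ∈ (C z).verts}
    face_injective := fun _ _ h => h
    S_root := hG.splitSub_root h
    S_child := fun x hx => by
      have h1 := hG.splitSub_parent (hG.height_ne_zero hx)
      have h2 := hG.splitSub_height_succ x
      rw [← h1] at h2
      exact h2
    C_root := if_pos rfl
    C_child := fun x hx => if_neg hx
    dualVerts_eq := fun x => by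
      ext f
      exact ⟨fun hf => ⟨f, hf, rfl⟩, fun ⟨z, hz, hf⟩ => hf ▸ hz⟩
    dualVerts_root := Set.eq_univ_of_forall fun f => (hG.tree_le_iff h).2 ⟨0, hG.splitFace_zero f h⟩
    dualVerts_child := fun x hx => by
      ext f
      have h1 := hG.splitSub_parent (hG.height_ne_zero hx)
      have h2 := hG.le_iff_mem_dualComponent h (x := x) (y := f)
      rw [← h1] at h2
      exact h2
    subfaces_frame := fun x hx => by
      have h1 := hG.splitSub_parent (hG.height_ne_zero hx)
      have h3 := (hG.exists_frame (hG.height_ne_zero hx) h1).choose_spec.1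
      refine h3.trans ?_
      ext f
      have h2 := hG.le_iff_mem_dualComponent h (x := x) (y := f)
      rw [← h1] at h2
      exact h2.symm
    downEdges_eq := fun _ _ => rfl }

theorem framesTwoOrFour_decomposition (hG : SingleSourcePlane G s) (h : G.Face) :
    (hG.decomposition h).FramesTwoOrFour := fun _ hx =>
  (hG.exists_frame (hG.height_ne_zero hx)
    (hG.splitSub_parent (hG.height_ne_zero hx))).choose_spec.2

theorem depth_decomposition_le (hG : SingleSourcePlane G s) (h : G.Face)
    (x : (hG.decomposition h).tree) : (hG.decomposition h).depth x ≤ hG.height x := by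
  have hsub : Set.Iio x ⊆ (fun i => splitFace s (G := G) x i) '' Set.Iio (hG.height x) := by
    intro y hy
    obtain ⟨i, hi⟩ := (hG.tree_le_iff h).1 (le_of_lt hy)
    refine ⟨i, Set.mem_Iio.2 (lt_of_not_ge fun hle => ?_), hi⟩
    have := hG.splitFace_of_le (hG.splitFace_height x) hle
    exact (Set.mem_Iio.1 hy).ne (hi.symm.trans this)
  have hfin : (Set.Iio (hG.height x)).Finite := Set.finite_Iio _
  refine (Set.ncard_le_ncard hsub (hfin.image _)).trans ((Set.ncard_image_le hfin).trans ?_)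
  rw [← Nat.card_coe_set_eq]
  simp

end SingleSourcePlane

end EmbeddedDigraph

theorem mainTheorem2 :
    ∃ K : ℝ, ∀ (V : Type u) [Fintype V] (G : EmbeddedDigraph V),
      G.IsPlane → G.toDigraph.IsAcyclic → G.toDigraph.IsSingleSource →
        ∃ D : G.STDecomposition,
          D.HeightLE (K * Real.log (Fintype.card V)) ∧ D.FramesTwoOrFour := by
  -- With `n` vertices there are at most `n ^ 2` faces, so 2 to the depth is at most `n ^ 4`.
  refine ⟨4 / Real.log 2, fun V _ G hpl hac ⟨s, hs⟩ => ?_⟩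
  have hG : EmbeddedDigraph.SingleSourcePlane G s := ⟨hpl, hac, hs⟩
  have hne : Nonempty G.Face := by
    by_cases he : ∃ e : G.toDigraph.Edge, e.tail = s ∨ e.head = s
    · exact ⟨EmbeddedDigraph.dartFace (he.choose, true)⟩
    · push Not at he
      exact ⟨EmbeddedDigraph.faceOf (Sum.inr ⟨s, trivial, fun e _ => he e⟩)⟩
  obtain ⟨h⟩ := hne
  refine ⟨hG.decomposition h, fun x => ?_, hG.framesTwoOrFour_decomposition h⟩
  have h1 := hG.depth_decomposition_le h x
  have h2 := hG.two_pow_height_le x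
  have h3 := hG.card_face_le
  rw [Nat.card_eq_fintype_card (α := V)] at h3
  have h4 : 2 ^ (hG.decomposition h).depth x ≤ Fintype.card V ^ 4 :=
    calc 2 ^ (hG.decomposition h).depth x ≤ 2 ^ hG.height x := Nat.pow_le_pow_right two_pos h1
      _ ≤ Nat.card G.Face ^ 2 := h2
      _ ≤ (Fintype.card V ^ 2) ^ 2 := Nat.pow_le_pow_left h3 2
      _ = Fintype.card V ^ 4 := by ring
  have h5 : Real.log ((2 : ℝ) ^ (hG.decomposition h).depth x) ≤
      Real.log ((Fintype.card V : ℝ) ^ 4) :=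
    Real.log_le_log (by positivity) (by exact_mod_cast h4)
  rw [Real.log_pow, Real.log_pow] at h5
  have h6 : 0 < Real.log 2 := Real.log_pos one_lt_two
  rw [div_mul_eq_mul_div, le_div_iff₀ h6]
  exact_mod_cast h5
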